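/- Let $\nu$ be a negative integer, $b>0$ and $\alpha>1$ real, and put $\beta=\frac1{\alpha-1}$ and $z=\frac{(\alpha-1)b^2}{4}$. Let $$I_{1\alpha}=\int_0^\infty x^{\nu}\,[1+(\alpha-1)x]^{-\frac1{\alpha-1}}\,e^{-bx^{-1/2}}\,dx .$$ Write $\psi=\Gamma'/\Gamma$, $(a)_r=a(a+1)\cdots(a+r-1)$ with $(a)_0=1$, and ${}_1F_2(a;b_1,b_2;w)=\sum_{r\ge0}\frac{(a)_r}{(b_1)_r(b_2)_r}\frac{w^r}{r!}$. Then the integral and the two infinite series below converge absolutely, and $$\begin{aligned} I_{1\alpha}=\frac{1}{\sqrt{\pi}\,(\alpha-1)^{\nu+1}\,\Gamma(\beta)}\Big\{&-2\sqrt{\pi}\,\Gamma\big(\beta-\tfrac12-\nu\big)\Gamma\big(\tfrac12+\nu\big)\,z^{1/2}\;{}_1F_2\big(\beta-\tfrac12-\nu;\tfrac32,\tfrac12-\nu;-z\big)\\ &+\Gamma(-1-\nu)\,\Gamma\big(-\tfrac12-\nu\big)\,\Gamma(\beta)\,z^{1+\nu}\sum_{r=0}^{-\nu-2}\frac{(-1)^r}{r!}\,\frac{(\beta)_r}{(\frac32+\nu)_r\,(2+\nu)_r}\,z^r\\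 &+\sum_{r=0}^\infty z^r\,\big[-\ln z+A'_r\big]\,B'_r\Big\}, \end{aligned}$$ where $$A'_r=\psi\big(\tfrac12-r\big)-\psi(\beta-1-\nu+r)+\psi(1+r)+\psi(r-\nu),\qquad B'_r=\frac{(-1)^{1+\nu}\,\Gamma(\tfrac12-r)\,\Gamma(\beta-1-\nu+r)}{r!\,(r-\nu-1)!},$$ and where for $\nu=-1$ the second summand in braces (an empty sum) is $0$. -/

import Mathlib

open MeasureTheory Set
open scoped Nat

noncomputable section

namespace PathwayIntegral

/-- The psi (digamma) function on the real line: the logarithmic derivative `Γ' / Γ`. -/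
def psi (x : ℝ) : ℝ := logDeriv Real.Gamma x

/-- Away from the poles of the gamma function, `psi` is Mathlib's complex digamma function. -/
theorem ofReal_psi (x : ℝ) (hx : ∀ m : ℕ, x ≠ -m) :
    ((psi x : ℝ) : ℂ) = Complex.digamma (x : ℂ) := by
  have hc : ∀ m : ℕ, (x : ℂ) ≠ -m := fun m h => hx m (by exact_mod_cast h)
  have h1 := ((Real.differentiableAt_Gamma hx).hasDerivAt).ofReal_comp
  have h2 := ((Complex.differentiableAt_Gamma (x : ℂ) hc).hasDerivAt).comp_ofReal
  simp only [Complex.Gamma_ofReal] at h2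
  have h3 := h1.unique h2
  simp only [psi, Complex.digamma_def, logDeriv_apply, Complex.ofReal_div, h3,
    Complex.Gamma_ofReal]

/-- The rising factorial `(a)_r = a (a + 1) ⋯ (a + r - 1)`, with `(a)_0 = 1`. -/
def poch (a : ℝ) (r : ℕ) : ℝ := (ascPochhammer ℝ r).eval a

/-- The `r`-th term of the hypergeometric series `₁F₂(a; b, c; z)`. -/
def hyp1F2Term (a b c z : ℝ) (r : ℕ) : ℝ :=
  poch a r / (poch b r * poch c r) * (z ^ r / r !)

/-- The hypergeometric function `₁F₂(a; b, c; z)`. -/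
def hyp1F2 (a b c z : ℝ) : ℝ := ∑' r : ℕ, hyp1F2Term a b c z r

/-- The integrand `x^(γ-1) [1 + a(α-1)x]^(-1/(α-1)) exp(-b x^(-ρ))`. -/
def integrand (γ a ρ b α x : ℝ) : ℝ :=
  x ^ (γ - 1) * (1 + a * (α - 1) * x) ^ (-(1 / (α - 1))) * Real.exp (-b * x ^ (-ρ))

/-- The extended reaction probability integral `I_{1α}`. -/
def I1 (γ a ρ b α : ℝ) : ℝ := ∫ x in Ioi (0 : ℝ), integrand γ a ρ b α x

/-- The coefficient `A'_r`. -/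
def coeffA (ν : ℤ) (α : ℝ) (r : ℕ) : ℝ :=
  psi (1 / 2 - r) - psi (1 / (α - 1) - 1 - ν + r) + psi (1 + r) + psi (r - ν)

/-- The coefficient `B'_r`; for `ν < 0` the integer `r - ν - 1` is nonnegative. -/
def coeffB (ν : ℤ) (α : ℝ) (r : ℕ) : ℝ :=
  (-1) ^ (1 + ν) * Real.Gamma (1 / 2 - r) * Real.Gamma (1 / (α - 1) - 1 - ν + r) /
    ((r ! : ℝ) * (((r : ℤ) - ν - 1).toNat ! : ℝ))

/-- The `r`-th term `z^r [-ln z + A'_r] B'_r` of the logarithmic series. -/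
def logTerm (ν : ℤ) (α z : ℝ) (r : ℕ) : ℝ :=
  z ^ r * (-Real.log z + coeffA ν α r) * coeffB ν α r

end PathwayIntegral

end

noncomputable section

namespace PathwayIntegral

open Filter Topology Real

/-! Write `ν = -(K+1)`, `a = α - 1`, `β = 1/a`. Representing `(1 + a x)^(-β)` by a Gamma integral in
`u` and exchanging integrals turns `Γ(β) I` into `a^K ∫ u^(β+K-1) e^(-u) F_{2K+2}(2√(z u)) du`,
where `F_j(c) = ∫ y^(-j/2) exp(-y - c y^(-1/2)) dy` is `kernelIntegral j c` (`Gamma_mul_I1`). It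
remains to expand `F_{2K+2}` near the origin and integrate term by term.

Since `F_j' = -F_{j+1}`, everything follows from `F_0`. Integrating the `y`-derivative of `exp(-y -
c y^(-1/2))` gives `c F_0''' = -2 F_0`, whose Frobenius solutions at `0` have the form `∑ (p_n + q_n
log c) c^n`. A solution is fixed by the limits at `0` of `F_0`, `F_1` and `F_2 + 2 log c`, which are
`1`, `√π` and `-3γ` (`tendsto_kernelIntegral_two` is the delicate one). The explicit series
`kernelSum` satisfies the same equation with the same limits, so `eq_zero_of_system` identifies the
two (`kernelIntegral_eq_kernelSum`).

Differentiating `2K+2` times and putting `c = 2√w` splits the series by index: odd indices give the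
`√w` series, even indices below the order give the finite sum of negative powers, and the remaining
even ones give the logarithmic series (`kernelIntegral_expansion`). Against `u^(s-1) e^(-u)`, powers
of `u` produce Gamma values, and `log u` produces `Γ'`, the source of `-ψ(β-1-ν+r)` in `A'_r`. -/

/-! ### Kernel integrals and their differential equation -/

/-- The kernel `y^(-j/2) exp(-y - c y^(-1/2))`. -/
def kernel (j : ℕ) (c y : ℝ) : ℝ := (y ^ (-(1 / 2) : ℝ)) ^ j * Real.exp (-y - c * y ^ (-(1 / 2) : ℝ))

/-- The integral of `kernel j c` over the half line. -/
def kernelIntegral (j : ℕ) (c : ℝ) : ℝ := ∫ y in Ioi (0 : ℝ), kernel j c y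

theorem kernel_nonneg (j : ℕ) (c : ℝ) {y : ℝ} (hy : 0 < y) : 0 ≤ kernel j c y := by
  unfold kernel; positivity

theorem pow_mul_exp_neg_le (j : ℕ) {c v : ℝ} (hc : 0 < c) (hv : 0 ≤ v) :
    v ^ j * Real.exp (-(c * v)) ≤ j ! / c ^ j := by
  have h := Real.pow_div_factorial_le_exp (c * v) (by positivity) j
  rw [Real.exp_neg, ← div_eq_mul_inv, div_le_div_iff₀ (Real.exp_pos _) (by positivity)]
  rw [div_le_iff₀ (by positivity), mul_pow] at h
  linarith

theorem kernel_le (j : ℕ) {c y : ℝ} (hc : 0 < c) (hy : 0 < y) :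
    kernel j c y ≤ j ! / c ^ j * Real.exp (-y) := by
  have h := pow_mul_exp_neg_le j hc (Real.rpow_nonneg hy.le (-(1 / 2) : ℝ))
  have : kernel j c y = (y ^ (-(1 / 2) : ℝ)) ^ j * Real.exp (-(c * y ^ (-(1 / 2) : ℝ)))
      * Real.exp (-y) := by
    unfold kernel
    rw [mul_assoc, ← Real.exp_add]; ring_nf
  rw [this]
  gcongr

theorem kernel_anti (j : ℕ) {c d y : ℝ} (hcd : c ≤ d) (hy : 0 < y) :
    kernel j d y ≤ kernel j c y := by
  unfold kernel; gcongr

theorem measurable_kernel (j : ℕ) (c : ℝ) : Measurable (kernel j c) := by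
  unfold kernel; fun_prop

theorem integrableOn_exp_neg : IntegrableOn (fun y : ℝ => Real.exp (-y)) (Ioi 0) :=
  integrableOn_exp_neg_Ioi 0

theorem integrableOn_kernel (j : ℕ) {c : ℝ} (hc : 0 < c) : IntegrableOn (kernel j c) (Ioi 0) := by
  refine (integrableOn_exp_neg.const_mul (j ! / c ^ j)).mono'
    (measurable_kernel j c).aestronglyMeasurable ?_
  filter_upwards [ae_restrict_mem measurableSet_Ioi] with y hy
  rw [Real.norm_of_nonneg (kernel_nonneg j c hy)]
  exact kernel_le j hc hy

/-- Each `c`-derivative brings down a factor `-y^(-1/2)`. The kernel decreases in `c`, so its value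
at `c / 2` dominates on a neighbourhood of `c`. -/
theorem hasDerivAt_kernelIntegral (j : ℕ) {c : ℝ} (hc : 0 < c) :
    HasDerivAt (kernelIntegral j) (-kernelIntegral (j + 1) c) c := by
  have := (hasDerivAt_integral_of_dominated_loc_of_deriv_le
    (μ := volume.restrict (Ioi (0 : ℝ))) (F := kernel j) (F' := fun d y => -kernel (j + 1) d y)
    (x₀ := c) (s := Ioi (c / 2)) (bound := kernel (j + 1) (c / 2))
    (Ioi_mem_nhds (by linarith))
    (Eventually.of_forall fun d => (measurable_kernel j d).aestronglyMeasurable)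
    (integrableOn_kernel j hc) (measurable_kernel (j + 1) c).neg.aestronglyMeasurable ?_
    (integrableOn_kernel (j + 1) (by positivity)) ?_).2
  · rwa [integral_neg] at this
  · filter_upwards [ae_restrict_mem measurableSet_Ioi] with y hy d hd
    rw [norm_neg, Real.norm_of_nonneg (kernel_nonneg _ _ hy)]
    exact kernel_anti _ (le_of_lt hd) hy
  · filter_upwards with y d _
    unfold kernel
    have : HasDerivAt (fun d : ℝ => -y - d * y ^ (-(1 / 2) : ℝ)) (-(1 * y ^ (-(1 / 2) : ℝ))) d :=
      ((hasDerivAt_id d).mul_const _).const_sub _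
    refine (this.exp.const_mul ((y ^ (-(1 / 2) : ℝ)) ^ j)).congr_deriv ?_
    rw [pow_succ]
    ring

theorem tendsto_rpow_neg_half : Tendsto (fun y : ℝ => y ^ (-(1 / 2) : ℝ)) (𝓝[>] 0) atTop :=
  tendsto_rpow_neg_nhdsGT_zero (by norm_num)

theorem hasDerivAt_exp_kernel (c : ℝ) {y : ℝ} (hy : 0 < y) :
    HasDerivAt (fun y : ℝ => Real.exp (-y - c * y ^ (-(1 / 2) : ℝ)))
      (c / 2 * kernel 3 c y - kernel 0 c y) y := by
  have h1 : HasDerivAt (fun y : ℝ => y ^ (-(1 / 2) : ℝ))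
      (-(1 / 2) * y ^ (-(1 / 2) - 1 : ℝ)) y := Real.hasDerivAt_rpow_const (Or.inl hy.ne')
  have h2 := (((hasDerivAt_id y).neg).sub (h1.const_mul c)).exp
  refine h2.congr_deriv ?_
  have h3 : (y ^ (-(1 / 2) : ℝ)) ^ 3 = y ^ (-(1 / 2) - 1 : ℝ) := by
    rw [← Real.rpow_mul_natCast hy.le]; norm_num
  unfold kernel
  rw [h3]
  simp
  ring

theorem tendsto_kernel_zero (j : ℕ) {c : ℝ} (hc : 0 < c) : Tendsto (kernel j c) (𝓝[>] 0) (𝓝 0) := by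
  have h := (tendsto_pow_mul_exp_neg_atTop_nhds_zero (j)).comp
    (tendsto_rpow_neg_half.const_mul_atTop hc)
  have h2 := h.const_mul (1 / c ^ j)
  rw [mul_zero] at h2
  refine squeeze_zero' ?_ ?_ h2
  · filter_upwards [self_mem_nhdsWithin] with y hy using kernel_nonneg j c hy
  · filter_upwards [self_mem_nhdsWithin] with y hy
    have hy : 0 < y := hy
    simp only [Function.comp, mul_pow, kernel]
    rw [← mul_assoc, ← mul_assoc, one_div_mul_cancel (pow_ne_zero j hc.ne'), one_mul]
    gcongr
    linarith

/-- The function `exp(-y - c y^(-1/2))` vanishes at both ends of the half line, so its derivative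
integrates to zero. Together with `hasDerivAt_kernelIntegral` this is the equation `c F''' = -2 F`.
-/
theorem kernelIntegral_zero_eq {c : ℝ} (hc : 0 < c) :
    kernelIntegral 0 c = c / 2 * kernelIntegral 3 c := by
  -- In Lean `0 ^ (-1/2) = 0`, so the unmodified exponential would equal `1` at `y = 0`; the case
  -- split restores the limit `0` there.
  have h := integral_Ioi_of_hasDerivAt_of_tendsto
    (f := fun y => if y ≤ 0 then 0 else Real.exp (-y - c * y ^ (-(1 / 2) : ℝ)))
    (f' := fun y => c / 2 * kernel 3 c y - kernel 0 c y) (a := 0) (m := 0) ?_ ?_ ?_ ?_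
  · rw [integral_sub ((integrableOn_kernel 3 hc).const_mul _) (integrableOn_kernel 0 hc),
      integral_const_mul] at h
    simp only [le_refl, if_true, sub_zero] at h
    unfold kernelIntegral
    linarith
  · rw [← continuousWithinAt_Ioi_iff_Ici, ContinuousWithinAt]
    simp only [le_refl, if_true]
    refine (tendsto_kernel_zero 0 hc).congr' ?_
    filter_upwards [self_mem_nhdsWithin] with y hy
    simp [kernel, not_le.2 (show 0 < y from hy)]
  · intro y hy
    refine (hasDerivAt_exp_kernel c hy).congr_of_eventuallyEq ?_
    filter_upwards [Ioi_mem_nhds hy] with x hx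
    simp [not_le.2 (show 0 < x from hx)]
  · exact ((integrableOn_kernel 3 hc).const_mul _).sub (integrableOn_kernel 0 hc)
  · have : Tendsto (fun y : ℝ => Real.exp (-y)) atTop (𝓝 0) := tendsto_exp_neg_atTop_nhds_zero
    refine squeeze_zero' ?_ ?_ this
    · filter_upwards [eventually_gt_atTop 0] with y hy
      simp only [not_le.2 hy, if_false]; positivity
    · filter_upwards [eventually_gt_atTop 0] with y hy
      simp only [not_le.2 hy, if_false]
      gcongr
      have : 0 ≤ c * y ^ (-(1 / 2) : ℝ) := by positivity
      linarith

/-! ### Logarithmic moments and the derivative of Gamma -/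

theorem abs_log_le_rpow {u ε : ℝ} (hu : 0 < u) (hε : 0 < ε) :
    |Real.log u| ≤ u ^ ε / ε + u ^ (-ε) / ε := by
  have h1 := Real.log_le_rpow_div hu.le hε
  have h2 := Real.log_le_rpow_div (inv_pos.2 hu).le hε
  rw [Real.log_inv, Real.inv_rpow hu.le, ← Real.rpow_neg hu.le] at h2
  have h3 : 0 < u ^ ε / ε := by positivity
  have h4 : 0 < u ^ (-ε) / ε := by positivity
  rw [abs_le]
  constructor <;> linarith

theorem integrableOn_rpow_mul_exp_neg {s a : ℝ} (hs : 0 < s) (ha : 0 < a) :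
    IntegrableOn (fun u : ℝ => u ^ (s - 1) * Real.exp (-(a * u))) (Ioi 0) := by
  have := integrableOn_rpow_mul_exp_neg_mul_rpow (s := s - 1) (p := 1) (b := a)
    (by linarith) one_pos ha
  simpa using this

theorem integrableOn_rpow_mul_abs_log_mul_exp_neg {s a : ℝ} (hs : 0 < s) (ha : 0 < a) :
    IntegrableOn (fun u : ℝ => u ^ (s - 1) * |Real.log u| * Real.exp (-(a * u))) (Ioi 0) := by
  -- The logarithm is bounded with `ε = s / 2`, which keeps both shifted exponents `s ± s / 2`
  -- positive.
  have h1 := integrableOn_rpow_mul_exp_neg (s := s + s / 2) (by linarith) ha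
  have h2 := integrableOn_rpow_mul_exp_neg (s := s - s / 2) (by linarith) ha
  refine ((h1.add h2).const_mul (1 / (s / 2))).mono'
    (Measurable.aestronglyMeasurable (by fun_prop)) ?_
  filter_upwards [ae_restrict_mem measurableSet_Ioi] with u hu
  have hu : 0 < u := hu
  rw [Real.norm_of_nonneg (by positivity)]
  have h3 := abs_log_le_rpow hu (half_pos hs)
  calc u ^ (s - 1) * |Real.log u| * Real.exp (-(a * u))
      ≤ u ^ (s - 1) * (u ^ (s / 2) / (s / 2) + u ^ (-(s / 2)) / (s / 2))
          * Real.exp (-(a * u)) := by gcongr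
    _ = _ := by
      rw [Pi.add_apply, show s + s / 2 - 1 = (s - 1) + s / 2 by ring,
        show s - s / 2 - 1 = (s - 1) + -(s / 2) by ring, Real.rpow_add hu, Real.rpow_add hu]
      ring

theorem integrableOn_rpow_mul_log_mul_exp_neg {s : ℝ} (hs : 0 < s) :
    IntegrableOn (fun u : ℝ => u ^ (s - 1) * Real.log u * Real.exp (-u)) (Ioi 0) := by
  refine (integrableOn_rpow_mul_abs_log_mul_exp_neg hs one_pos).mono'
    (Measurable.aestronglyMeasurable (by fun_prop)) ?_
  filter_upwards [ae_restrict_mem measurableSet_Ioi] with u hu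
  have hu : 0 < u := hu
  rw [norm_mul, norm_mul, Real.norm_of_nonneg (Real.rpow_nonneg hu.le _),
    Real.norm_of_nonneg (Real.exp_pos _).le, one_mul, Real.norm_eq_abs]

theorem integral_rpow_mul_log_mul_exp_neg {s : ℝ} (hs : 0 < s) :
    ∫ u in Ioi (0 : ℝ), u ^ (s - 1) * Real.log u * Real.exp (-u) = deriv Real.Gamma s := by
  have h1 := (Complex.hasDerivAt_GammaIntegral (s := (s : ℂ)) (by simpa using hs))
  have h2 : HasDerivAt Complex.Gamma
      (∫ t : ℝ in Ioi 0, (t : ℂ) ^ ((s : ℂ) - 1) * (Real.log t * Real.exp (-t))) s := by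
    refine h1.congr_of_eventuallyEq ?_
    have : {w : ℂ | 0 < w.re} ∈ 𝓝 (s : ℂ) :=
      (isOpen_lt continuous_const Complex.continuous_re).mem_nhds (by simpa using hs)
    filter_upwards [this] with w hw using Complex.Gamma_eq_integral hw
  have h3 : (∫ t : ℝ in Ioi 0, (t : ℂ) ^ ((s : ℂ) - 1) * (Real.log t * Real.exp (-t)))
      = ((∫ u in Ioi (0 : ℝ), u ^ (s - 1) * Real.log u * Real.exp (-u) : ℝ) : ℂ) := by
    rw [← integral_complex_ofReal]
    refine setIntegral_congr_fun measurableSet_Ioi fun t ht => ?_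
    have ht : 0 < t := ht
    simp only [Complex.ofReal_mul, Complex.ofReal_cpow ht.le, Complex.ofReal_sub,
      Complex.ofReal_one]
    ring
  rw [h3] at h2
  have h4 : HasDerivAt Real.Gamma _ s := h2.real_of_complex
  rw [h4.deriv, Complex.ofReal_re]

theorem integral_log_mul_exp_neg :
    ∫ u in Ioi (0 : ℝ), Real.log u * Real.exp (-u) = -eulerMascheroniConstant := by
  have := integral_rpow_mul_log_mul_exp_neg one_pos
  rw [Real.hasDerivAt_Gamma_one.deriv] at this
  simpa using this

theorem integrableOn_log_mul_exp_neg :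
    IntegrableOn (fun u : ℝ => Real.log u * Real.exp (-u)) (Ioi 0) := by
  simpa using integrableOn_rpow_mul_log_mul_exp_neg one_pos

/-! ### Limits of the kernel integrals at the origin -/

theorem tendsto_kernel (j : ℕ) (y : ℝ) :
    Tendsto (fun c => kernel j c y) (𝓝[>] 0) (𝓝 ((y ^ (-(1 / 2) : ℝ)) ^ j * Real.exp (-y))) := by
  have : Continuous fun c => kernel j c y := by unfold kernel; fun_prop
  have h := (this.tendsto 0).mono_left (nhdsWithin_le_nhds (s := Ioi 0))
  simpa [kernel] using h

theorem kernel_le_at_zero (j : ℕ) {c y : ℝ} (hc : 0 < c) (hy : 0 < y) :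
    kernel j c y ≤ (y ^ (-(1 / 2) : ℝ)) ^ j * Real.exp (-y) := by
  have := kernel_anti j hc.le hy
  simpa [kernel] using this

theorem tendsto_kernelIntegral_zero : Tendsto (kernelIntegral 0) (𝓝[>] 0) (𝓝 1) := by
  have h := tendsto_integral_filter_of_dominated_convergence
    (μ := volume.restrict (Ioi (0 : ℝ))) (l := 𝓝[>] (0 : ℝ)) (F := kernel 0)
    (f := fun y => (y ^ (-(1 / 2) : ℝ)) ^ 0 * Real.exp (-y)) (fun y => Real.exp (-y))
    (Eventually.of_forall fun c => (measurable_kernel 0 c).aestronglyMeasurable) ?_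
    integrableOn_exp_neg (Eventually.of_forall fun y => tendsto_kernel 0 y)
  · simp only [pow_zero, one_mul] at h
    rwa [integral_exp_neg_Ioi_zero] at h
  · filter_upwards [self_mem_nhdsWithin] with c hc
    filter_upwards [ae_restrict_mem measurableSet_Ioi] with y hy
    rw [Real.norm_of_nonneg (kernel_nonneg _ _ hy)]
    simpa using kernel_le_at_zero 0 hc hy

theorem tendsto_kernelIntegral_one : Tendsto (kernelIntegral 1) (𝓝[>] 0) (𝓝 (√π)) := by
  have h := tendsto_integral_filter_of_dominated_convergence
    (μ := volume.restrict (Ioi (0 : ℝ))) (l := 𝓝[>] (0 : ℝ)) (F := kernel 1)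
    (f := fun y => (y ^ (-(1 / 2) : ℝ)) ^ 1 * Real.exp (-y))
    (fun y => (y ^ (-(1 / 2) : ℝ)) ^ 1 * Real.exp (-y))
    (Eventually.of_forall fun c => (measurable_kernel 1 c).aestronglyMeasurable) ?_
    ?_ (Eventually.of_forall fun y => tendsto_kernel 1 y)
  · have e : √π = ∫ y in Ioi (0 : ℝ), (y ^ (-(1 / 2) : ℝ)) ^ 1 * Real.exp (-y) := by
      rw [← Real.Gamma_one_half_eq, Real.Gamma_eq_integral (by norm_num)]
      congr 1 with y
      norm_num [mul_comm]
    rwa [e]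
  · filter_upwards [self_mem_nhdsWithin] with c hc
    filter_upwards [ae_restrict_mem measurableSet_Ioi] with y hy
    rw [Real.norm_of_nonneg (kernel_nonneg _ _ hy)]
    exact kernel_le_at_zero 1 hc hy
  · have := integrableOn_rpow_mul_exp_neg (s := 1 / 2) (a := 1) (by norm_num) one_pos
    norm_num at this
    norm_num
    exact this

theorem integrableOn_log_mul_kernel (j : ℕ) {c : ℝ} (hc : 0 < c) :
    IntegrableOn (fun y => Real.log y * kernel j c y) (Ioi 0) := by
  refine (integrableOn_log_mul_exp_neg.norm.const_mul (j ! / c ^ j)).mono'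
    (Real.measurable_log.mul (measurable_kernel j c)).aestronglyMeasurable ?_
  filter_upwards [ae_restrict_mem measurableSet_Ioi] with y hy
  rw [norm_mul, Real.norm_of_nonneg (kernel_nonneg j c hy), norm_mul,
    Real.norm_of_nonneg (Real.exp_pos _).le]
  have := kernel_le j hc hy
  calc _ ≤ ‖Real.log y‖ * (j ! / c ^ j * Real.exp (-y)) := by gcongr
    _ = _ := by ring

/-- Integration by parts with `y⁻¹ = (log y)'`. At `c = 0` the factor `y⁻¹` is not integrable, and
this replaces it by logarithms whose divergence can be isolated. -/
theorem kernelIntegral_two_eq {c : ℝ} (hc : 0 < c) :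
    kernelIntegral 2 c = (∫ y in Ioi (0 : ℝ), Real.log y * kernel 0 c y)
      - c / 2 * ∫ y in Ioi (0 : ℝ), Real.log y * kernel 3 c y := by
  have e : ∀ y ∈ Ioi (0 : ℝ), kernel 2 c y = y⁻¹ * Real.exp (-y - c * y ^ (-(1 / 2) : ℝ)) := by
    intro y hy
    have hy : 0 < y := hy
    have h3 : (y ^ (-(1 / 2) : ℝ)) ^ 2 = y⁻¹ := by
      rw [← Real.rpow_mul_natCast hy.le, ← Real.rpow_neg_one]; norm_num
    simp only [kernel, h3]
  have e0 : ∀ y, Real.exp (-y - c * y ^ (-(1 / 2) : ℝ)) = kernel 0 c y := by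
    intro y; simp [kernel]
  have i2 : IntegrableOn (fun y => y⁻¹ * Real.exp (-y - c * y ^ (-(1 / 2) : ℝ))) (Ioi 0) :=
    (integrableOn_kernel 2 hc).congr_fun e measurableSet_Ioi
  have i3 : IntegrableOn (fun y => Real.log y * (c / 2 * kernel 3 c y - kernel 0 c y)) (Ioi 0) := by
    refine IntegrableOn.congr_fun (((integrableOn_log_mul_kernel 3 hc).const_mul (c / 2)).sub
      (integrableOn_log_mul_kernel 0 hc)) (fun y _ => ?_) measurableSet_Ioi
    simp only [Pi.sub_apply]
    ring
  have h := integral_Ioi_deriv_mul_eq_sub (a := 0) (a' := 0) (b' := 0)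
    (u := Real.log) (u' := fun y => y⁻¹)
    (v := fun y => Real.exp (-y - c * y ^ (-(1 / 2) : ℝ)))
    (v' := fun y => c / 2 * kernel 3 c y - kernel 0 c y)
    (fun y hy => Real.hasDerivAt_log (ne_of_gt hy)) (fun y hy => hasDerivAt_exp_kernel c hy)
    (i2.add i3) ?_ ?_
  · rw [integral_add i2 i3] at h
    have h2 : (∫ y in Ioi (0 : ℝ), Real.log y * (c / 2 * kernel 3 c y - kernel 0 c y))
        = c / 2 * (∫ y in Ioi (0 : ℝ), Real.log y * kernel 3 c y)
          - ∫ y in Ioi (0 : ℝ), Real.log y * kernel 0 c y := by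
      rw [← integral_const_mul, ← integral_sub
        ((integrableOn_log_mul_kernel 3 hc).const_mul (c / 2)) (integrableOn_log_mul_kernel 0 hc)]
      congr 1 with y
      ring
    rw [kernelIntegral, setIntegral_congr_fun measurableSet_Ioi e]
    linarith
  · have h1 := (tendsto_kernel_zero 1 hc).const_mul 2
    rw [mul_zero] at h1
    refine squeeze_zero_norm' ?_ h1
    filter_upwards [Ioo_mem_nhdsGT one_pos] with y hy
    rw [Pi.mul_apply, e0, norm_mul, Real.norm_of_nonneg (kernel_nonneg _ _ hy.1)]
    have h5 : ‖Real.log y‖ ≤ 2 * y ^ (-(1 / 2) : ℝ) := by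
      have h2 := Real.log_le_rpow_div (inv_pos.2 hy.1).le one_half_pos
      rw [Real.log_inv, Real.inv_rpow hy.1.le, ← Real.rpow_neg hy.1.le] at h2
      rw [Real.norm_eq_abs, abs_of_neg (Real.log_neg hy.1 hy.2)]
      linarith
    calc _ ≤ 2 * y ^ (-(1 / 2) : ℝ) * kernel 0 c y := by
          gcongr; exact kernel_nonneg _ _ hy.1
      _ = _ := by simp [kernel]; ring
  · have h1 := tendsto_pow_mul_exp_neg_atTop_nhds_zero 1
    refine squeeze_zero_norm' ?_ h1
    filter_upwards [eventually_ge_atTop 1] with y hy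
    have hy0 : 0 < y := by linarith
    rw [Pi.mul_apply, e0, norm_mul, Real.norm_of_nonneg (kernel_nonneg _ _ hy0), pow_one,
      Real.norm_of_nonneg (Real.log_nonneg hy)]
    have h2 := kernel_le_at_zero 0 hc hy0
    rw [pow_zero, one_mul] at h2
    exact mul_le_mul (Real.log_le_self hy0.le) h2 (kernel_nonneg _ _ hy0) hy0.le

/-- `exp(-c²/v²-v)`. -/
def recipKernel (c v : ℝ) : ℝ := Real.exp (-(c / v) ^ 2 - v)

theorem recipKernel_le (c : ℝ) (v : ℝ) : recipKernel c v ≤ Real.exp (-v) := by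
  unfold recipKernel; gcongr; nlinarith [sq_nonneg (c / v)]

theorem measurable_recipKernel (c : ℝ) : Measurable (recipKernel c) := by
  unfold recipKernel; fun_prop

theorem integrableOn_recipKernel (c : ℝ) : IntegrableOn (recipKernel c) (Ioi 0) := by
  refine integrableOn_exp_neg.mono' (measurable_recipKernel c).aestronglyMeasurable ?_
  filter_upwards with v
  rw [Real.norm_of_nonneg (r := recipKernel c v) (Real.exp_pos _).le]
  exact recipKernel_le c v

theorem norm_log_mul_recipKernel_le (c v : ℝ) :
    ‖Real.log v * recipKernel c v‖ ≤ ‖Real.log v * Real.exp (-v)‖ := by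
  rw [norm_mul, norm_mul, Real.norm_of_nonneg (Real.exp_pos _).le,
    Real.norm_of_nonneg (r := recipKernel c v) (Real.exp_pos _).le]
  gcongr
  exact recipKernel_le c v

theorem measurable_log_mul_recipKernel (c : ℝ) :
    Measurable fun v => Real.log v * recipKernel c v :=
  Real.measurable_log.mul (measurable_recipKernel c)

theorem integrableOn_log_mul_recipKernel (c : ℝ) :
    IntegrableOn (fun v => Real.log v * recipKernel c v) (Ioi 0) := by
  refine integrableOn_log_mul_exp_neg.norm.mono'
    (measurable_log_mul_recipKernel c).aestronglyMeasurable ?_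
  filter_upwards with v using norm_log_mul_recipKernel_le c v

/-- Under `v = c y^(-1/2)` the measure `(c/2) y^(-3/2) dy` becomes `dv`, the exponent becomes
`-(c/v)² - v`, and `log y = 2 log c - 2 log v`. The divergence is now the explicit `2 log c`. -/
theorem integral_log_mul_kernel_three {c : ℝ} (hc : 0 < c) :
    c / 2 * ∫ y in Ioi (0 : ℝ), Real.log y * kernel 3 c y =
      2 * Real.log c * (∫ v in Ioi (0 : ℝ), recipKernel c v)
        - 2 * ∫ v in Ioi (0 : ℝ), Real.log v * recipKernel c v := by
  have h1 := integral_comp_mul_left_Ioi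
    (fun v => (2 * Real.log c - 2 * Real.log v) * recipKernel c v) 0 hc
  have h2 := integral_comp_rpow_Ioi
    (fun v => (2 * Real.log c - 2 * Real.log (c * v)) * recipKernel c (c * v))
    (p := -(1 / 2)) (by norm_num)
  have h3 : (∫ v in Ioi (0 : ℝ), (2 * Real.log c - 2 * Real.log v) * recipKernel c v)
      = 2 * Real.log c * (∫ v in Ioi (0 : ℝ), recipKernel c v)
        - 2 * ∫ v in Ioi (0 : ℝ), Real.log v * recipKernel c v := by
    rw [← integral_const_mul, ← integral_const_mul, ← integral_sub
      ((integrableOn_recipKernel c).const_mul _) ((integrableOn_log_mul_recipKernel c).const_mul _)]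
    congr 1 with v
    ring
  rw [mul_zero, smul_eq_mul, ← h2, h3] at h1
  rw [eq_comm, inv_mul_eq_iff_eq_mul₀ hc.ne'] at h1
  rw [h1, ← integral_const_mul, ← integral_const_mul]
  refine setIntegral_congr_fun measurableSet_Ioi fun y hy => ?_
  have hy : 0 < y := hy
  have h4 : (y ^ (-(1 / 2) : ℝ)) ^ 3 = y ^ (-(1 / 2) - 1 : ℝ) := by
    rw [← Real.rpow_mul_natCast hy.le]; norm_num
  have h5 : (c / (c * y ^ (-(1 / 2) : ℝ))) ^ 2 = y := by
    rw [div_mul_eq_div_div, div_self hc.ne', one_div, ← Real.rpow_neg hy.le,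
      ← Real.rpow_mul_natCast hy.le]
    norm_num
  simp only [kernel, recipKernel, smul_eq_mul]
  rw [Real.log_mul hc.ne' (Real.rpow_pos_of_pos hy _).ne', Real.log_rpow hy, h4, h5,
    abs_of_neg (by norm_num)]
  ring

theorem one_sub_exp_neg_pow_four_le {x : ℝ} (hx : 0 ≤ x) : 1 - Real.exp (-x ^ 4) ≤ x := by
  rcases le_total x 1 with h | h
  · have h1 := Real.add_one_le_exp (-x ^ 4)
    have h2 : x ^ 4 ≤ x ^ 1 := pow_le_pow_of_le_one hx h (by norm_num)
    linarith
  · have := Real.exp_pos (-x ^ 4)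
    linarith

/-- Convergence of the integral to `1` is not enough against `log c`; a rate is needed. The deficit
is at most `c^(1/2) Γ(1/2)`. -/
theorem tendsto_log_mul_one_sub_integral_recipKernel :
    Tendsto (fun c => Real.log c * (1 - ∫ v in Ioi (0 : ℝ), recipKernel c v))
      (𝓝[>] 0) (𝓝 0) := by
  have h0 := (tendsto_log_mul_rpow_nhdsGT_zero (r := 1 / 2) (by norm_num)).norm.mul_const
    (Real.Gamma (1 / 2))
  rw [norm_zero, zero_mul] at h0
  refine squeeze_zero_norm' ?_ h0
  filter_upwards [self_mem_nhdsWithin] with c hc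
  have hc : 0 < c := hc
  rw [norm_mul, norm_mul, mul_assoc]
  gcongr
  have h1 : 1 - ∫ v in Ioi (0 : ℝ), recipKernel c v
      = ∫ v in Ioi (0 : ℝ), (Real.exp (-v) - recipKernel c v) := by
    rw [integral_sub integrableOn_exp_neg (integrableOn_recipKernel c), integral_exp_neg_Ioi_zero]
  have h2 : c ^ (1 / 2 : ℝ) * Real.Gamma (1 / 2)
      = ∫ v in Ioi (0 : ℝ), c ^ (1 / 2 : ℝ) * (Real.exp (-v) * v ^ (1 / 2 - 1 : ℝ)) := by
    rw [integral_const_mul, Real.Gamma_eq_integral (by norm_num)]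
  rw [Real.norm_of_nonneg (Real.rpow_nonneg hc.le _), h1, h2]
  refine norm_integral_le_of_norm_le ((Real.GammaIntegral_convergent (by norm_num)).const_mul _) ?_
  filter_upwards [ae_restrict_mem measurableSet_Ioi] with v hv
  have hv : 0 < v := hv
  rw [Real.norm_of_nonneg (sub_nonneg.2 (recipKernel_le c v))]
  -- The exponent `1/2` gives a positive power of `c` while leaving `v^(-1/2)` integrable at `0`.
  have h3 := one_sub_exp_neg_pow_four_le (x := (c / v) ^ (1 / 2 : ℝ)) (by positivity)
  have h4 : ((c / v) ^ (1 / 2 : ℝ)) ^ 4 = (c / v) ^ 2 := by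
    rw [← Real.rpow_mul_natCast (by positivity), ← Real.rpow_natCast]; norm_num
  rw [h4] at h3
  have h5 : recipKernel c v = Real.exp (-(c / v) ^ 2) * Real.exp (-v) := by
    rw [recipKernel, ← Real.exp_add]; ring_nf
  have h6 : v ^ (1 / 2 - 1 : ℝ) = (v ^ (1 / 2 : ℝ))⁻¹ := by
    rw [← Real.rpow_neg hv.le]; norm_num
  rw [h5, h6]
  rw [Real.div_rpow hc.le hv.le] at h3
  calc _ = (1 - Real.exp (-(c / v) ^ 2)) * Real.exp (-v) := by ring
    _ ≤ c ^ (1 / 2 : ℝ) / v ^ (1 / 2 : ℝ) * Real.exp (-v) := by gcongr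
    _ = _ := by ring

theorem tendsto_integral_log_mul_kernel_zero :
    Tendsto (fun c => ∫ y in Ioi (0 : ℝ), Real.log y * kernel 0 c y) (𝓝[>] 0)
      (𝓝 (-eulerMascheroniConstant)) := by
  rw [← integral_log_mul_exp_neg]
  refine tendsto_integral_filter_of_dominated_convergence
    (fun y => ‖Real.log y * Real.exp (-y)‖)
    (Eventually.of_forall fun c =>
      (Real.measurable_log.mul (measurable_kernel 0 c)).aestronglyMeasurable) ?_
    integrableOn_log_mul_exp_neg.norm (Eventually.of_forall fun y => ?_)
  · filter_upwards [self_mem_nhdsWithin] with c hc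
    filter_upwards [ae_restrict_mem measurableSet_Ioi] with y hy
    rw [norm_mul, norm_mul, Real.norm_of_nonneg (kernel_nonneg _ _ hy),
      Real.norm_of_nonneg (Real.exp_pos _).le]
    gcongr
    simpa using kernel_le_at_zero 0 hc hy
  · simpa using (tendsto_kernel 0 y).const_mul (Real.log y)

theorem tendsto_integral_log_mul_recipKernel :
    Tendsto (fun c => ∫ v in Ioi (0 : ℝ), Real.log v * recipKernel c v) (𝓝[>] 0)
      (𝓝 (-eulerMascheroniConstant)) := by
  rw [← integral_log_mul_exp_neg]
  refine tendsto_integral_filter_of_dominated_convergence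
    (fun y => ‖Real.log y * Real.exp (-y)‖)
    (Eventually.of_forall fun c => (measurable_log_mul_recipKernel c).aestronglyMeasurable)
    (Eventually.of_forall fun c => Eventually.of_forall fun v => norm_log_mul_recipKernel_le c v)
    integrableOn_log_mul_exp_neg.norm (Eventually.of_forall fun v => ?_)
  have : Continuous fun c => Real.log v * recipKernel c v := by unfold recipKernel; fun_prop
  have h := (this.tendsto 0).mono_left (nhdsWithin_le_nhds (s := Ioi 0))
  simpa [recipKernel] using h

/-- The two logarithmic integrals contribute `-γ` and `-2γ`; the surviving `log c` is multiplied by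
a deficit that kills it. -/
theorem tendsto_kernelIntegral_two :
    Tendsto (fun c => kernelIntegral 2 c + 2 * Real.log c) (𝓝[>] 0)
      (𝓝 (-3 * eulerMascheroniConstant)) := by
  have h := (tendsto_integral_log_mul_kernel_zero.add
    (tendsto_log_mul_one_sub_integral_recipKernel.const_mul 2)).add
    (tendsto_integral_log_mul_recipKernel.const_mul 2)
  rw [show -3 * eulerMascheroniConstant = -eulerMascheroniConstant + 2 * 0
    + 2 * -eulerMascheroniConstant by ring]
  refine h.congr' ?_
  filter_upwards [self_mem_nhdsWithin] with c hc
  rw [kernelIntegral_two_eq hc, integral_log_mul_kernel_three hc]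
  ring

/-! ### Power series with logarithmic terms -/

/-- The coefficients `u` define an everywhere convergent power series. -/
def EntireCoeff (u : ℕ → ℝ) : Prop := ∀ R : ℝ, Summable fun n => u n * R ^ n

/-- The sum of the power series with coefficients `u`. -/
def powerSum (u : ℕ → ℝ) (c : ℝ) : ℝ := ∑' n, u n * c ^ n

theorem EntireCoeff.add {u v : ℕ → ℝ} (hu : EntireCoeff u) (hv : EntireCoeff v) :
    EntireCoeff (fun n => u n + v n) := fun R => by
  simpa [add_mul] using (hu R).add (hv R)

theorem EntireCoeff.const_mul {u : ℕ → ℝ} (hu : EntireCoeff u) (a : ℝ) :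
    EntireCoeff (fun n => a * u n) := fun R => by
  simpa [mul_assoc] using (hu R).mul_left a

/-- The factor `n ≤ 2^n` is absorbed by doubling the radius. -/
theorem EntireCoeff.natCast_mul {u : ℕ → ℝ} (hu : EntireCoeff u) :
    EntireCoeff (fun n => (n : ℝ) * u n) := fun R => by
  refine Summable.of_norm_bounded (hu (2 * R)).norm fun n => ?_
  have h : (n : ℝ) ≤ 2 ^ n := by exact_mod_cast Nat.lt_two_pow_self.le
  rw [mul_pow, norm_mul, norm_mul, norm_mul, norm_mul, norm_pow (2 : ℝ), Real.norm_natCast,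
    Real.norm_two]
  have : (0 : ℝ) ≤ ‖u n‖ * ‖R ^ n‖ := by positivity
  nlinarith

theorem EntireCoeff.sub_mul {u : ℕ → ℝ} (hu : EntireCoeff u) (j : ℝ) :
    EntireCoeff (fun n => ((n : ℝ) - j) * u n) := fun R => by
  refine (hu.natCast_mul.add (hu.const_mul (-j)) R).congr fun n => ?_
  ring

/-- Dividing by `c` keeps the index unshifted: `c d/dc` acts on coefficients as multiplication by
`n`. -/
theorem hasDerivAt_powerSum {u : ℕ → ℝ} (hu : EntireCoeff u) {c : ℝ} (hc : 0 < c) :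
    HasDerivAt (powerSum u) (powerSum (fun n => (n : ℝ) * u n) c / c) c := by
  have hR : 0 < c + 1 := by linarith
  have h := hasDerivAt_tsum_of_isPreconnected (𝕜 := ℝ) (F := ℝ)
    (u := fun n : ℕ => ‖(n : ℝ) * u n * (c + 1) ^ n‖ / (c + 1))
    (g := fun (n : ℕ) y => u n * y ^ n) (g' := fun (n : ℕ) y => u n * (n * y ^ (n - 1)))
    (t := Ioo 0 (c + 1)) (y₀ := c) (y := c)
    ((hu.natCast_mul (c + 1)).norm.div_const _) isOpen_Ioo isPreconnected_Ioo
    (fun n y _ => (hasDerivAt_pow n y).const_mul _) (fun n y hy => ?_)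
    ⟨hc, by linarith⟩ (hu c) ⟨hc, by linarith⟩
  · refine h.congr_deriv ?_
    rw [powerSum, ← tsum_div_const]
    congr 1 with n
    rcases n with _ | n
    · simp
    · rw [Nat.add_sub_cancel, pow_succ]
      field_simp
  · rcases n with _ | n
    · simp
    · have h1 : ‖u (n + 1) * (((n + 1 : ℕ) : ℝ) * y ^ (n + 1 - 1))‖
          = ((n + 1 : ℕ) : ℝ) * ‖u (n + 1)‖ * y ^ n := by
        rw [Nat.add_sub_cancel, norm_mul, norm_mul, norm_pow, Real.norm_of_nonneg hy.1.le,
          Real.norm_natCast]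
        ring
      have h2 : ‖((n + 1 : ℕ) : ℝ) * u (n + 1) * (c + 1) ^ (n + 1)‖ / (c + 1)
          = ((n + 1 : ℕ) : ℝ) * ‖u (n + 1)‖ * (c + 1) ^ n := by
        rw [norm_mul, norm_mul, norm_pow, Real.norm_of_nonneg hR.le, Real.norm_natCast, pow_succ]
        field_simp
      rw [h1, h2]
      have := hy.1.le
      have := hy.2.le
      gcongr

theorem tendsto_powerSum {u : ℕ → ℝ} (hu : EntireCoeff u) :
    Tendsto (powerSum u) (𝓝[>] 0) (𝓝 (u 0)) := by
  have h : ContinuousOn (powerSum u) (Icc 0 1) := by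
    refine continuousOn_tsum (u := fun n => ‖u n * 1 ^ n‖) (fun n => by fun_prop) (hu 1).norm
      fun n x hx => ?_
    rw [norm_mul, norm_mul, one_pow, norm_one, norm_pow, Real.norm_of_nonneg hx.1]
    gcongr
    exact pow_le_one₀ hx.1 hx.2
  have h1 := (h 0 (by simp)).mono_left (nhdsWithin_mono 0 Ioc_subset_Icc_self)
  rw [nhdsWithin_Ioc_eq_nhdsGT one_pos] at h1
  convert h1 using 2
  rw [powerSum, tsum_eq_single 0 fun n hn => by simp [hn]]
  simp

theorem powerSum_add {u v : ℕ → ℝ} (hu : EntireCoeff u) (hv : EntireCoeff v) (c : ℝ) :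
    powerSum (fun n => u n + v n) c = powerSum u c + powerSum v c := by
  simp only [powerSum, add_mul]
  exact (hu c).tsum_add (hv c)

theorem powerSum_const_mul (u : ℕ → ℝ) (a c : ℝ) :
    powerSum (fun n => a * u n) c = a * powerSum u c := by
  simp only [powerSum, mul_assoc, tsum_mul_left]

theorem powerSum_sub_mul {u : ℕ → ℝ} (hu : EntireCoeff u) (j c : ℝ) :
    powerSum (fun n => ((n : ℝ) - j) * u n) c
      = powerSum (fun n => (n : ℝ) * u n) c - j * powerSum u c := by
  have := powerSum_add hu.natCast_mul (hu.const_mul (-j)) c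
  rw [powerSum_const_mul] at this
  rw [sub_eq_add_neg, ← neg_mul, ← this]
  congr 1 with n
  ring

/-- The pair of coefficient sequences of `c^j` times the `j`-th derivative of
`∑ (p n + q n log c) c^n`. -/
def logCoeff (p q : ℕ → ℝ) : ℕ → (ℕ → ℝ) × (ℕ → ℝ)
  | 0 => (p, q)
  | j + 1 => (fun n => ((n : ℝ) - j) * (logCoeff p q j).1 n + (logCoeff p q j).2 n,
      fun n => ((n : ℝ) - j) * (logCoeff p q j).2 n)

theorem entireCoeff_logCoeff {p q : ℕ → ℝ} (hp : EntireCoeff p) (hq : EntireCoeff q) (j : ℕ) :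
    EntireCoeff (logCoeff p q j).1 ∧ EntireCoeff (logCoeff p q j).2 := by
  induction j with
  | zero => exact ⟨hp, hq⟩
  | succ j ih => exact ⟨(ih.1.sub_mul j).add ih.2, ih.2.sub_mul j⟩

/-- The `j`-th derivative of `∑ (p n + q n log c) c^n`. -/
def logSum (p q : ℕ → ℝ) (j : ℕ) (c : ℝ) : ℝ :=
  (c ^ j)⁻¹ * (powerSum (logCoeff p q j).1 c + Real.log c * powerSum (logCoeff p q j).2 c)

/-- With `θ = c d/dc`, differentiating `c^(-j) (P + Q log c)` gives `c^(-j-1) ((θ - j) P + Q + log c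
(θ - j) Q)`, which is the recursion of `logCoeff`. -/
theorem hasDerivAt_logSum {p q : ℕ → ℝ} (hp : EntireCoeff p) (hq : EntireCoeff q) (j : ℕ)
    {c : ℝ} (hc : 0 < c) : HasDerivAt (logSum p q j) (logSum p q (j + 1) c) c := by
  obtain ⟨h1, h2⟩ := entireCoeff_logCoeff hp hq j
  have d := ((hasDerivAt_pow j c).inv (pow_ne_zero j hc.ne')).mul
    ((hasDerivAt_powerSum h1 hc).add
      ((Real.hasDerivAt_log hc.ne').mul (hasDerivAt_powerSum h2 hc)))
  refine d.congr_deriv ?_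
  simp only [logSum, logCoeff]
  rw [powerSum_add (h1.sub_mul j) h2, powerSum_sub_mul h1, powerSum_sub_mul h2]
  simp only [Pi.add_apply, Pi.mul_apply, Pi.inv_apply]
  have hc' := hc.ne'
  rcases j with _ | j
  · simp; field_simp; ring
  · rw [Nat.add_sub_cancel]
    field_simp
    ring

/-! ### Uniqueness for the third-order system -/

/-- Both `A x^(k+1)/(k+1) ∓ f` are monotone with limit `0` at `0⁺`, hence nonnegative. Only the
limit of `f` at the origin is used, not a value there. -/
theorem abs_le_of_hasDerivAt_of_tendsto {f f' : ℝ → ℝ} {A T : ℝ} (k : ℕ)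
    (hf : ∀ c ∈ Ioc 0 T, HasDerivAt f (f' c) c) (h0 : Tendsto f (𝓝[>] 0) (𝓝 0))
    (hb : ∀ c ∈ Ioc 0 T, |f' c| ≤ A * c ^ k) :
    ∀ c ∈ Ioc 0 T, |f c| ≤ A * c ^ (k + 1) / (k + 1) := by
  have key : ∀ s : ℝ, |s| = 1 → ∀ c ∈ Ioc 0 T, s * f c ≤ A * c ^ (k + 1) / (k + 1) := by
    intro s hs c hc
    have hd : ∀ x ∈ Ioc 0 T, HasDerivAt (fun x => A * x ^ (k + 1) / (k + 1) - s * f x)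
        (A * x ^ k - s * f' x) x := by
      intro x hx
      refine ((((hasDerivAt_pow (k + 1) x).const_mul A).div_const _).sub
        ((hf x hx).const_mul s)).congr_deriv ?_
      rw [Nat.add_sub_cancel]; push_cast
      have : (k : ℝ) + 1 ≠ 0 := by positivity
      field_simp
    have hm : MonotoneOn (fun x => A * x ^ (k + 1) / (k + 1) - s * f x) (Ioc 0 T) := by
      refine monotoneOn_of_hasDerivWithinAt_nonneg (convex_Ioc 0 T)
        (fun x hx => (hd x hx).continuousAt.continuousWithinAt)
        (fun x hx => (hd x (interior_subset hx)).hasDerivWithinAt) fun x hx => ?_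
      have h1 := hb x (interior_subset hx)
      have h2 : s * f' x ≤ |f' x| := by
        calc _ ≤ |s * f' x| := le_abs_self _
          _ = _ := by rw [abs_mul, hs, one_mul]
      linarith
    have ht : Tendsto (fun x => A * x ^ (k + 1) / (k + 1) - s * f x) (𝓝[>] 0) (𝓝 0) := by
      have h3 : Continuous fun x : ℝ => A * x ^ (k + 1) / ((k : ℝ) + 1) := by fun_prop
      have h4 := ((h3.tendsto 0).mono_left (nhdsWithin_le_nhds (s := Ioi 0))).sub (h0.const_mul s)
      simpa using h4
    have := le_of_tendsto (b := A * c ^ (k + 1) / (k + 1) - s * f c) ht ?_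
    · linarith
    · filter_upwards [Ioo_mem_nhdsGT hc.1] with x hx
      exact hm ⟨hx.1, hx.2.le.trans hc.2⟩ hc hx.2.le
  intro c hc
  rw [abs_le]
  have h1 := key 1 (by simp) c hc
  have h2 := key (-1) (by simp) c hc
  constructor <;> linarith

/-- A solution of `d₀' = -d₁`, `d₁' = -d₂`, `d₂' = -(2/c) d₀` on the half line that vanishes at
the origin is zero. -/
theorem eq_zero_of_system {d₀ d₁ d₂ : ℝ → ℝ}
    (h0 : ∀ c, 0 < c → HasDerivAt d₀ (-d₁ c) c) (h1 : ∀ c, 0 < c → HasDerivAt d₁ (-d₂ c) c)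
    (h2 : ∀ c, 0 < c → HasDerivAt d₂ (-(2 / c * d₀ c)) c)
    (t0 : Tendsto d₀ (𝓝[>] 0) (𝓝 0)) (t1 : Tendsto d₁ (𝓝[>] 0) (𝓝 0))
    (t2 : Tendsto d₂ (𝓝[>] 0) (𝓝 0)) {c : ℝ} (hc : 0 < c) : d₀ c = 0 := by
  obtain ⟨B, hB⟩ : ∃ B, ∀ x ∈ Ioc 0 c, |d₂ x| ≤ B := by
    -- Setting `d₂` to its limit `0` at the origin makes it continuous on a compact interval, hence
    -- bounded.
    have hcont : ContinuousOn (Function.update d₂ 0 0) (Icc 0 c) := by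
      intro x hx
      rcases hx.1.eq_or_lt with rfl | hx0
      · rw [continuousWithinAt_update_same]
        refine t2.mono_left (nhdsWithin_mono _ fun y hy => ?_)
        exact lt_of_le_of_ne hy.1.1 (Ne.symm hy.2)
      · refine ContinuousAt.continuousWithinAt ?_
        exact (continuousAt_update_of_ne hx0.ne').2 (h2 x hx0).continuousAt
    obtain ⟨B, hB⟩ := isCompact_Icc.exists_bound_of_continuousOn hcont
    refine ⟨B, fun x hx => ?_⟩
    have := hB x ⟨hx.1.le, hx.2⟩
    rwa [Function.update_of_ne hx.1.ne'] at this
  -- Each round of integrations through `d₁`, `d₀` and back to `d₂` gains a factor `x²`, and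
  -- dividing by `2n + 2` in the last one turns `n!` into `(n+1)!`. The bound tends to `0` as `n`
  -- grows, forcing `d₂ = 0`.
  have key : ∀ n : ℕ, ∀ x ∈ Ioc 0 c, |d₂ x| ≤ B * 2 ^ n / n ! * x ^ (2 * n) := by
    intro n
    induction n with
    | zero => simpa using hB
    | succ n ih =>
      have hB0 : 0 ≤ B := (abs_nonneg _).trans (hB c ⟨hc, le_rfl⟩)
      have i1 := abs_le_of_hasDerivAt_of_tendsto (2 * n) (fun x hx => h1 x hx.1) t1
        (by simpa using ih)
      have i1' : ∀ x ∈ Ioc 0 c, |d₁ x| ≤ B * 2 ^ n / n ! * x ^ (2 * n + 1) := by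
        intro x hx
        refine (i1 x hx).trans (div_le_self ?_ ?_)
        · have := hx.1.le; positivity
        · simp
      have i0 := abs_le_of_hasDerivAt_of_tendsto (2 * n + 1) (fun x hx => h0 x hx.1) t0
        (by simpa using i1')
      have i0' : ∀ x ∈ Ioc 0 c, |d₀ x| ≤ B * 2 ^ n / n ! * x ^ (2 * n + 1 + 1) := by
        intro x hx
        refine (i0 x hx).trans (div_le_self ?_ ?_)
        · have := hx.1.le; positivity
        · push_cast; linarith [(Nat.cast_nonneg n : (0 : ℝ) ≤ n)]
      have i2 := abs_le_of_hasDerivAt_of_tendsto (A := 2 * (B * 2 ^ n / n !)) (2 * n + 1)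
        (fun x hx => h2 x hx.1) t2 fun x hx => by
          have hx0 := hx.1
          rw [abs_neg, abs_mul, abs_of_pos (by positivity)]
          calc _ ≤ 2 / x * (B * 2 ^ n / n ! * x ^ (2 * n + 1 + 1)) := by
                gcongr; exact i0' x hx
            _ = _ := by rw [pow_succ]; field_simp
      intro x hx
      refine (i2 x hx).trans ?_
      have hx0 := hx.1
      rw [Nat.factorial_succ, pow_succ 2 n, show 2 * (n + 1) = 2 * n + 1 + 1 by ring]
      push_cast
      rw [div_le_iff₀ (by positivity)]
      have : B * (2 ^ n * 2) / ((n + 1) * (n ! : ℝ)) * x ^ (2 * n + 1 + 1) * (2 * n + 1 + 1)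
          = 2 * (2 * (B * 2 ^ n / n !) * x ^ (2 * n + 1 + 1)) := by
        field_simp
        ring
      rw [this]
      have : 0 ≤ 2 * (B * 2 ^ n / n !) * x ^ (2 * n + 1 + 1) := by positivity
      linarith
  have z2 : ∀ x ∈ Ioc 0 c, d₂ x = 0 := by
    intro x hx
    have ht : Tendsto (fun n : ℕ => B * 2 ^ n / n ! * x ^ (2 * n)) atTop (𝓝 0) := by
      have := (FloorSemiring.tendsto_pow_div_factorial_atTop (2 * x ^ 2)).const_mul B
      rw [mul_zero] at this
      refine this.congr fun n => ?_
      rw [mul_pow, pow_mul]; ring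
    have := ge_of_tendsto' ht fun n => key n x hx
    exact abs_nonpos_iff.1 this
  have e1 := abs_le_of_hasDerivAt_of_tendsto (A := 0) (T := c) 0 (fun x hx => h1 x hx.1) t1
    fun x hx => by simp [z2 x hx]
  have e0 := abs_le_of_hasDerivAt_of_tendsto (A := 0) (T := c) 0 (fun x hx => h0 x hx.1) t0
    fun x hx => by simpa using e1 x hx
  simpa using e0 c ⟨hc, le_rfl⟩

/-! ### The Frobenius series of the kernel integral -/

theorem cast_harmonic_succ (n : ℕ) :
    ((harmonic (n + 1) : ℚ) : ℝ) = (harmonic n : ℚ) + 1 / ((n : ℝ) + 1) := by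
  rw [harmonic_succ]; push_cast; rw [one_div]

theorem abs_cast_harmonic_le (n : ℕ) : |((harmonic n : ℚ) : ℝ)| ≤ n := by
  induction n with
  | zero => simp
  | succ n ih =>
    rw [cast_harmonic_succ]
    refine (abs_add_le _ _).trans ?_
    push_cast
    gcongr
    rw [abs_of_pos (by positivity), div_le_one (by positivity)]
    linarith [(Nat.cast_nonneg n : (0 : ℝ) ≤ n)]

/-- At index `n = j + k` the factors `n (n-1) ⋯ (n-j+1)` equal `(j+k)!/k!`. Differentiating `log c`
contributes the logarithmic derivative of this product in `n`, namely `H_{j+k} - H_k`. -/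
theorem logCoeff_add (P Q : ℕ → ℝ) (j k : ℕ) :
    (logCoeff (fun n => P n / n !) (fun n => Q n / n !) j).1 (j + k)
      = (P (j + k) + Q (j + k) * ((harmonic (j + k) : ℚ) - (harmonic k : ℚ))) / k ! ∧
    (logCoeff (fun n => P n / n !) (fun n => Q n / n !) j).2 (j + k) = Q (j + k) / k ! := by
  induction j generalizing k with
  | zero => simp [logCoeff]
  | succ j ih =>
    have h1 := (ih (k + 1)).1
    have h2 := (ih (k + 1)).2
    rw [← add_assoc, add_right_comm] at h1 h2
    have e : ((j + 1 + k : ℕ) : ℝ) - j = k + 1 := by push_cast; ring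
    have hk : (k : ℝ) + 1 ≠ 0 := by positivity
    simp only [logCoeff, h1, h2, e, Nat.factorial_succ, cast_harmonic_succ k]
    push_cast
    constructor <;> field_simp
    ring

/-- The factor `n - n = 0` removes the logarithm and the regular coefficient, leaving only what was
differentiated out of `log c`; later factors are `-1, -2, …, -k`. Thus negative powers come from the
logarithmic coefficients alone. -/
theorem logCoeff_lt (P Q : ℕ → ℝ) (n k : ℕ) :
    (logCoeff (fun n => P n / n !) (fun n => Q n / n !) (n + 1 + k)).1 n
      = Q n * (-1) ^ k * k ! ∧
    (logCoeff (fun n => P n / n !) (fun n => Q n / n !) (n + 1 + k)).2 n = 0 := by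
  induction k with
  | zero =>
    have h := (logCoeff_add P Q n 0).2
    rw [add_zero] at h
    simp [logCoeff, h]
  | succ k ih =>
    rw [← add_assoc]
    simp only [logCoeff, ih.1, ih.2, Nat.factorial_succ]
    push_cast
    constructor <;> ring

theorem entireCoeff_div_factorial {P : ℕ → ℝ} {C : ℝ} (hP : ∀ n, |P n| ≤ C * 2 ^ n) :
    EntireCoeff fun n => P n / n ! := fun R => by
  refine Summable.of_norm_bounded ((Real.summable_pow_div_factorial (2 * |R|)).mul_left C)
    fun n => ?_
  rw [norm_mul, norm_div, Real.norm_eq_abs, norm_pow, Real.norm_natCast, Real.norm_eq_abs, mul_pow]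
  calc _ ≤ C * 2 ^ n / n ! * |R| ^ n := by gcongr; exact hP n
    _ = _ := by ring

theorem EntireCoeff.shift {u : ℕ → ℝ} (hu : EntireCoeff u) : EntireCoeff fun n => u (n + 1) :=
  fun R => by
  refine Summable.of_norm_bounded (((summable_nat_add_iff 1).2 (hu (|R| + 1))).norm) fun n => ?_
  rw [norm_mul, norm_mul, norm_pow, norm_pow, Real.norm_of_nonneg (r := |R| + 1) (by positivity),
    Real.norm_eq_abs R]
  gcongr
  calc |R| ^ n ≤ (|R| + 1) ^ n := by gcongr; linarith
    _ ≤ _ := pow_le_pow_right₀ (by linarith [abs_nonneg R]) (Nat.le_succ n)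

theorem powerSum_eq_add_shift {u : ℕ → ℝ} (hu : EntireCoeff u) (c : ℝ) :
    powerSum u c = u 0 + c * powerSum (fun n => u (n + 1)) c := by
  rw [powerSum, (hu c).tsum_eq_zero_add, powerSum, ← tsum_mul_left]
  congr 1
  · simp
  · congr 1 with n; ring

/-- `n!` times the coefficient of `c^n` in `kernelIntegral 0 c`. -/
def regCoeff (n : ℕ) : ℝ :=
  if n = 0 then 1 else if Even n then
    (-1) ^ (n / 2 + 1) / ((n / 2 - 1)! : ℝ)
      * (2 * (harmonic n : ℚ) + (harmonic (n / 2 - 1) : ℚ) - 3 * eulerMascheroniConstant)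
  else -Real.Gamma (1 / 2 - (n / 2 : ℕ))

/-- `n!` times the coefficient of `c^n log c` in `kernelIntegral 0 c`. -/
def resCoeff (n : ℕ) : ℝ :=
  if n ≠ 0 ∧ Even n then 2 * (-1) ^ (n / 2) / ((n / 2 - 1)! : ℝ) else 0

theorem regCoeff_even (m : ℕ) : regCoeff (2 * m + 2) = (-1) ^ m / (m ! : ℝ)
    * (2 * (harmonic (2 * m + 2) : ℚ) + (harmonic m : ℚ) - 3 * eulerMascheroniConstant) := by
  have h : Even (2 * m + 2) := ⟨m + 1, by ring⟩
  have h2 : (2 * m + 2) / 2 = m + 1 := by omega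
  rw [regCoeff, if_neg (by omega), if_pos h, h2, Nat.add_sub_cancel, pow_add _ (m + 1), pow_succ]
  ring

theorem regCoeff_odd (m : ℕ) : regCoeff (2 * m + 1) = -Real.Gamma (1 / 2 - m) := by
  have h : ¬ Even (2 * m + 1) := by simp
  have h2 : (2 * m + 1) / 2 = m := by omega
  rw [regCoeff, if_neg (by omega), if_neg h, h2]

theorem resCoeff_even (m : ℕ) : resCoeff (2 * m + 2) = -2 * (-1) ^ m / (m ! : ℝ) := by
  have h : Even (2 * m + 2) := ⟨m + 1, by ring⟩
  have h2 : (2 * m + 2) / 2 = m + 1 := by omega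
  rw [resCoeff, if_pos ⟨by omega, h⟩, h2, Nat.add_sub_cancel, pow_succ]
  ring

theorem resCoeff_odd (m : ℕ) : resCoeff (2 * m + 1) = 0 := by
  simp [resCoeff]

theorem resCoeff_zero : resCoeff 0 = 0 := by simp [resCoeff]

theorem Gamma_half_sub_ne (m : ℕ) (k : ℕ) : (1 / 2 - m : ℝ) ≠ -k := by
  intro h
  have : (1 + 2 * k : ℝ) = 2 * m := by linarith
  have : 1 + 2 * k = 2 * m := by exact_mod_cast this
  omega

theorem Gamma_half_sub_eq (m : ℕ) : Real.Gamma (1 / 2 - m)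
    = (-1 / 2 - m) * Real.Gamma (1 / 2 - ((m + 1 : ℕ) : ℝ)) := by
  have := Real.Gamma_add_one (s := 1 / 2 - ((m + 1 : ℕ) : ℝ))
    (by simpa using Gamma_half_sub_ne (m + 1) 0)
  rw [show (1 / 2 - ((m + 1 : ℕ) : ℝ)) + 1 = 1 / 2 - m by push_cast; ring] at this
  rw [this]; push_cast; ring

theorem abs_Gamma_half_sub_le (m : ℕ) : |Real.Gamma (1 / 2 - m)| ≤ √π * 2 ^ m := by
  induction m with
  | zero =>
    rw [Nat.cast_zero, sub_zero, Real.Gamma_one_half_eq, pow_zero, mul_one,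
      abs_of_nonneg (Real.sqrt_nonneg _)]
  | succ m ih =>
    rw [Gamma_half_sub_eq, abs_mul, abs_of_neg
      (by linarith [(Nat.cast_nonneg m : (0 : ℝ) ≤ m)])] at ih
    rw [pow_succ]
    have : 0 ≤ (m : ℝ) * |Real.Gamma (1 / 2 - ((m + 1 : ℕ) : ℝ))| := by positivity
    linarith

theorem resCoeff_bound (n : ℕ) : |resCoeff n| ≤ 2 * 2 ^ n := by
  unfold resCoeff
  split_ifs
  · rw [abs_div, abs_mul, abs_pow, abs_neg, abs_one, one_pow, abs_two, Nat.abs_cast]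
    have h1 : (1 : ℝ) ≤ ((n / 2 - 1)! : ℝ) := by exact_mod_cast Nat.factorial_pos _
    have h2 : (1 : ℝ) ≤ 2 ^ n := one_le_pow₀ one_le_two
    rw [div_le_iff₀ (by linarith)]
    nlinarith
  · simp

theorem regCoeff_bound (n : ℕ) : |regCoeff n| ≤ 6 * 2 ^ n := by
  have h2 : (1 : ℝ) ≤ 2 ^ n := one_le_pow₀ one_le_two
  have hn : (n : ℝ) ≤ 2 ^ n := by exact_mod_cast Nat.lt_two_pow_self.le
  unfold regCoeff
  split_ifs
  · rw [abs_one]; linarith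
  · rw [abs_mul, abs_div, abs_pow, abs_neg, abs_one, one_pow, Nat.abs_cast]
    have h1 : (1 : ℝ) ≤ ((n / 2 - 1)! : ℝ) := by exact_mod_cast Nat.factorial_pos _
    have h3 := abs_cast_harmonic_le n
    have h4 := abs_cast_harmonic_le (n / 2 - 1)
    have h5 : ((n / 2 - 1 : ℕ) : ℝ) ≤ n := by exact_mod_cast (by omega : n / 2 - 1 ≤ n)
    have h6 := Real.eulerMascheroniConstant_lt_two_thirds
    have h7 := Real.one_half_lt_eulerMascheroniConstant
    have h8 : |2 * ((harmonic n : ℚ) : ℝ) + ((harmonic (n / 2 - 1) : ℚ) : ℝ)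
        - 3 * eulerMascheroniConstant| ≤ 6 * 2 ^ n := by
      rw [abs_le] at *
      constructor <;> linarith
    calc _ ≤ 1 * (6 * 2 ^ n : ℝ) := by
          gcongr
          rw [div_le_one (by linarith)]
          exact h1
      _ = _ := one_mul _
  · rw [abs_neg]
    refine (abs_Gamma_half_sub_le _).trans ?_
    have h3 : √π ≤ 6 := by
      rw [Real.sqrt_le_left (by norm_num)]; linarith [Real.pi_lt_four]
    gcongr
    · norm_num
    · exact Nat.div_le_self n 2

theorem entireCoeff_reg : EntireCoeff fun n => regCoeff n / n ! :=
  entireCoeff_div_factorial regCoeff_bound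

theorem entireCoeff_res : EntireCoeff fun n => resCoeff n / n ! :=
  entireCoeff_div_factorial resCoeff_bound

/-- This is `c³ F''' = -2 c² F` read at `c^(m+3)`. For odd indices it is the Gamma recurrence at
half-integers, for even ones the harmonic recurrence. -/
theorem regCoeff_recurrence (m : ℕ) :
    ((m : ℝ) + 1) * (regCoeff (3 + m)
      + resCoeff (3 + m) * ((harmonic (3 + m) : ℚ) - (harmonic m : ℚ))) = -2 * regCoeff (m + 1) ∧
    ((m : ℝ) + 1) * resCoeff (3 + m) = -2 * resCoeff (m + 1) := by
  rcases Nat.even_or_odd' m with ⟨k, rfl | rfl⟩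
  · rw [show 3 + 2 * k = 2 * (k + 1) + 1 by ring, regCoeff_odd, regCoeff_odd, resCoeff_odd,
      resCoeff_odd, Gamma_half_sub_eq k]
    push_cast
    constructor <;> ring
  · rw [show 3 + (2 * k + 1) = 2 * (k + 1) + 2 by ring, show 2 * k + 1 + 1 = 2 * k + 2 by ring,
      regCoeff_even, regCoeff_even, resCoeff_even, resCoeff_even, Nat.factorial_succ,
      cast_harmonic_succ k, pow_succ, cast_harmonic_succ (2 * k + 1)]
    have h1 : (k : ℝ) + 1 ≠ 0 := by positivity
    push_cast
    constructor
    · have : (2 * (k : ℝ) + 1 + 1) ≠ 0 := by positivity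
      field_simp
      ring
    · field_simp
      ring

/-- The logarithmic series for the `j`-th derivative of `kernelIntegral 0`. -/
def kernelSum (j : ℕ) (c : ℝ) : ℝ :=
  logSum (fun n => regCoeff n / n !) (fun n => resCoeff n / n !) j c

theorem hasDerivAt_kernelSum (j : ℕ) {c : ℝ} (hc : 0 < c) :
    HasDerivAt (kernelSum j) (kernelSum (j + 1) c) c :=
  hasDerivAt_logSum entireCoeff_reg entireCoeff_res j hc

theorem powerSum_eq_shift_three {u v : ℕ → ℝ} (hu : EntireCoeff u) (h0 : u 0 = 0) (h1 : u 1 = 0)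
    (h : ∀ n, u (n + 2) = -2 * v n) (c : ℝ) : powerSum u c = -2 * c ^ 2 * powerSum v c := by
  rw [powerSum_eq_add_shift hu, powerSum_eq_add_shift hu.shift, h0, zero_add, h1, zero_add]
  simp only [add_assoc, one_add_one_eq_two, h, powerSum_const_mul]
  ring

theorem kernelSum_three {c : ℝ} (hc : 0 < c) : kernelSum 3 c = -(2 / c * kernelSum 0 c) := by
  have e := entireCoeff_logCoeff entireCoeff_reg entireCoeff_res 3
  -- Indices `0, 1, 2` lie below the order of differentiation. The first two vanish, and the third
  -- is `resCoeff 2 = -2`, matching `-2 * regCoeff 0`.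
  have l0 := logCoeff_lt regCoeff resCoeff 0 2
  have l1 := logCoeff_lt regCoeff resCoeff 1 1
  have l2 := logCoeff_lt regCoeff resCoeff 2 0
  norm_num [resCoeff_zero] at l0
  norm_num [show resCoeff 1 = 0 from resCoeff_odd 0] at l1
  norm_num [resCoeff_even 0, show resCoeff 2 = _ from resCoeff_even 0] at l2
  rw [kernelSum, logSum, powerSum_eq_shift_three (v := fun n => regCoeff n / n !) e.1 l0.1 l1.1 ?_,
    powerSum_eq_shift_three (v := fun n => resCoeff n / n !) e.2 l0.2 l1.2 ?_]
  · simp only [kernelSum, logSum, logCoeff]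
    field_simp
    simp
    ring
  · rintro (_ | m)
    · simp [l2.2, resCoeff_zero]
    · rw [show m + 1 + 2 = 3 + m by ring, (logCoeff_add regCoeff resCoeff 3 m).2,
        ← mul_div_assoc, ← (regCoeff_recurrence m).2, Nat.factorial_succ]
      push_cast
      rw [mul_div_mul_left _ _ (by positivity)]
  · rintro (_ | m)
    · rw [zero_add, l2.1]; simp [regCoeff]
    · rw [show m + 1 + 2 = 3 + m by ring, (logCoeff_add regCoeff resCoeff 3 m).1,
        ← mul_div_assoc, ← (regCoeff_recurrence m).1, Nat.factorial_succ]
      push_cast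
      rw [mul_div_mul_left _ _ (by positivity)]

theorem tendsto_log_mul_powerSum {u : ℕ → ℝ} (hu : EntireCoeff u) :
    Tendsto (fun c => Real.log c * (c * powerSum u c)) (𝓝[>] 0) (𝓝 0) := by
  have h := (tendsto_log_mul_rpow_nhdsGT_zero one_pos).mul (tendsto_powerSum hu)
  rw [zero_mul] at h
  refine h.congr fun c => ?_
  rw [Real.rpow_one]; ring

theorem tendsto_kernelSum_zero : Tendsto (kernelSum 0) (𝓝[>] 0) (𝓝 1) := by
  have h := (tendsto_powerSum entireCoeff_reg).add (tendsto_log_mul_powerSum entireCoeff_res.shift)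
  rw [show regCoeff 0 / (0 ! : ℕ) + 0 = 1 by simp [regCoeff]] at h
  refine h.congr fun c => ?_
  rw [kernelSum, logSum]
  simp only [logCoeff]
  rw [powerSum_eq_add_shift entireCoeff_res, resCoeff_zero]
  simp

theorem tendsto_kernelSum_one : Tendsto (kernelSum 1) (𝓝[>] 0) (𝓝 (-√π)) := by
  obtain ⟨e1, e2⟩ := entireCoeff_logCoeff entireCoeff_reg entireCoeff_res 1
  have h := (tendsto_powerSum e1.shift).add (tendsto_log_mul_powerSum e2.shift.shift)
  have l0 := logCoeff_lt regCoeff resCoeff 0 0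
  have l1 := logCoeff_add regCoeff resCoeff 1 0
  norm_num [resCoeff_zero] at l0
  norm_num [show resCoeff 1 = 0 from resCoeff_odd 0, show regCoeff 1 = _ from regCoeff_odd 0,
    Real.Gamma_one_half_eq] at l1
  rw [zero_add, l1.1, add_zero] at h
  refine h.congr' ?_
  filter_upwards [self_mem_nhdsWithin] with c hc
  have hc : 0 < c := hc
  rw [kernelSum, logSum, powerSum_eq_add_shift e1, powerSum_eq_add_shift e2,
    powerSum_eq_add_shift e2.shift, l0.1, l0.2, zero_add 1, l1.2]
  field_simp
  ring

theorem tendsto_kernelSum_two :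
    Tendsto (fun c => kernelSum 2 c + 2 * Real.log c) (𝓝[>] 0)
      (𝓝 (-3 * eulerMascheroniConstant)) := by
  obtain ⟨e1, e2⟩ := entireCoeff_logCoeff entireCoeff_reg entireCoeff_res 2
  have h := (tendsto_powerSum e1.shift.shift).add (tendsto_log_mul_powerSum e2.shift.shift.shift)
  have l0 := logCoeff_lt regCoeff resCoeff 0 1
  have l1 := logCoeff_lt regCoeff resCoeff 1 0
  have l2 := logCoeff_add regCoeff resCoeff 2 0
  norm_num [resCoeff_zero] at l0
  norm_num [show resCoeff 1 = 0 from resCoeff_odd 0] at l1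
  norm_num [show resCoeff 2 = _ from resCoeff_even 0, show regCoeff 2 = _ from regCoeff_even 0,
    harmonic_succ] at l2
  rw [zero_add, one_add_one_eq_two, l2.1, add_zero] at h
  rw [show -3 * eulerMascheroniConstant = 3 - 3 * eulerMascheroniConstant + -3 by ring]
  refine h.congr' ?_
  filter_upwards [self_mem_nhdsWithin] with c hc
  have hc : 0 < c := hc
  rw [kernelSum, logSum, powerSum_eq_add_shift e1, powerSum_eq_add_shift e1.shift,
    powerSum_eq_add_shift e2, powerSum_eq_add_shift e2.shift, powerSum_eq_add_shift e2.shift.shift,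
    l0.1, l0.2, zero_add 1, l1.1, l1.2, one_add_one_eq_two, l2.2]
  field_simp
  ring

/-- For `j = 0` the difference solves the homogeneous system with zero limits, the `log c`
singularities of the second derivatives cancelling. Higher `j` follow by uniqueness of derivatives.
-/
theorem kernelIntegral_eq_kernelSum (j : ℕ) {c : ℝ} (hc : 0 < c) :
    kernelIntegral j c = (-1) ^ j * kernelSum j c := by
  induction j generalizing c with
  | zero =>
    have := eq_zero_of_system (d₀ := fun c => kernelIntegral 0 c - kernelSum 0 c)
      (d₁ := fun c => kernelIntegral 1 c + kernelSum 1 c)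
      (d₂ := fun c => kernelIntegral 2 c - kernelSum 2 c) ?_ ?_ ?_ ?_ ?_ ?_ hc
    · rw [pow_zero]; linarith
    · intro c hc
      refine ((hasDerivAt_kernelIntegral 0 hc).sub (hasDerivAt_kernelSum 0 hc)).congr_deriv ?_
      ring
    · intro c hc
      refine ((hasDerivAt_kernelIntegral 1 hc).add (hasDerivAt_kernelSum 1 hc)).congr_deriv ?_
      ring
    · intro c hc
      refine ((hasDerivAt_kernelIntegral 2 hc).sub (hasDerivAt_kernelSum 2 hc)).congr_deriv ?_
      rw [kernelIntegral_zero_eq hc, kernelSum_three hc]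
      field_simp
      ring
    · simpa using tendsto_kernelIntegral_zero.sub tendsto_kernelSum_zero
    · simpa using tendsto_kernelIntegral_one.add tendsto_kernelSum_one
    · simpa using tendsto_kernelIntegral_two.sub tendsto_kernelSum_two
  | succ j ih =>
    have h1 := hasDerivAt_kernelIntegral j hc
    have h2 : HasDerivAt (kernelIntegral j) ((-1) ^ j * kernelSum (j + 1) c) c := by
      refine ((hasDerivAt_kernelSum j hc).const_mul _).congr_of_eventuallyEq ?_
      filter_upwards [Ioi_mem_nhds hc] with x hx using ih hx
    have := h1.unique h2
    rw [pow_succ]; linarith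

/-! ### Digamma values, Pochhammer symbols and factorials -/

theorem psi_add_one {x : ℝ} (hx : ∀ m : ℕ, x ≠ -m) : psi (x + 1) = psi x + 1 / x := by
  have h1 : ∀ m : ℕ, x + 1 ≠ -m := fun m h => hx (m + 1) (by push_cast; linarith)
  have hc : ∀ m : ℕ, (x : ℂ) ≠ -m := fun m h => hx m (by exact_mod_cast h)
  have h2 := ofReal_psi (x + 1) h1
  rw [Complex.ofReal_add, Complex.ofReal_one, Complex.digamma_apply_add_one _ hc,
    ← ofReal_psi x hx] at h2
  rw [← Complex.ofReal_inj, h2]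
  push_cast
  rw [one_div]

theorem psi_natCast_add_one (n : ℕ) :
    psi (n + 1) = (harmonic n : ℚ) - eulerMascheroniConstant := by
  rw [psi, logDeriv_apply, Real.deriv_Gamma_nat, Real.Gamma_nat_eq_factorial,
    mul_div_cancel_left₀ _ (by positivity)]
  ring

/-- Descent from `ψ(1/2) = -γ - 2 log 2`. The term `-2 log 2` later matches the one from `log c` at
`c = 2√w`. -/
theorem psi_half_sub (r : ℕ) : psi (1 / 2 - r)
    = -eulerMascheroniConstant - 2 * Real.log 2 + 2 * (harmonic (2 * r) : ℚ) - (harmonic r : ℚ) := by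
  induction r with
  | zero =>
    rw [Nat.cast_zero, sub_zero, psi, logDeriv_apply, Real.hasDerivAt_Gamma_one_half.deriv,
      Real.Gamma_one_half_eq, neg_mul, neg_div, mul_div_cancel_left₀ _ (by positivity)]
    simp
    ring
  | succ r ih =>
    have h := psi_add_one (Gamma_half_sub_ne (r + 1))
    rw [show (1 / 2 - ((r + 1 : ℕ) : ℝ)) + 1 = 1 / 2 - r by push_cast; ring, ih] at h
    rw [show 2 * (r + 1) = 2 * r + 1 + 1 by ring, cast_harmonic_succ, cast_harmonic_succ,
      cast_harmonic_succ]
    have h1 : 1 / (1 / 2 - ((r + 1 : ℕ) : ℝ)) = -(2 / (2 * r + 1)) := by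
      rw [div_eq_iff (by simpa using Gamma_half_sub_ne (r + 1) 0)]
      push_cast
      field_simp
      ring
    have h2 : 1 / ((r : ℝ) + 1) = 2 * (1 / (((2 * r + 1 : ℕ) : ℝ) + 1)) := by
      push_cast
      field_simp
      ring
    rw [h1] at h
    rw [h2]
    push_cast at *
    linarith [show 2 / (2 * (r : ℝ) + 1) = 2 * (1 / (2 * r + 1)) by ring]

theorem poch_zero (a : ℝ) : poch a 0 = 1 := by simp [poch]

theorem poch_succ (a : ℝ) (r : ℕ) : poch a (r + 1) = poch a r * (a + r) := by
  simp [poch, ascPochhammer_succ_eval]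

theorem Gamma_add_natCast {a : ℝ} (ha : 0 < a) (r : ℕ) :
    Real.Gamma (a + r) = Real.Gamma a * poch a r := by
  induction r with
  | zero => simp [poch_zero]
  | succ r ih =>
    rw [Nat.cast_succ, ← add_assoc, Real.Gamma_add_one (by positivity), ih, poch_succ]
    ring

theorem poch_one_sub_mul_Gamma {x : ℝ} (r : ℕ) (hx : ∀ k < r, x - (k + 1) ≠ 0) :
    poch (1 - x) r * (-1) ^ r * Real.Gamma (x - r) = Real.Gamma x := by
  induction r with
  | zero => simp [poch_zero]
  | succ r ih =>
    have h := Real.Gamma_add_one (hx r (Nat.lt_succ_self r))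
    rw [show x - ((r : ℝ) + 1) + 1 = x - r by ring] at h
    rw [← ih fun k hk => hx k (hk.trans (Nat.lt_succ_self r)), h, poch_succ, pow_succ]
    push_cast
    ring

theorem four_pow_mul_factorial_mul_poch (r : ℕ) :
    (4 : ℝ) ^ r * r ! * poch (3 / 2) r = ((2 * r + 1)! : ℝ) := by
  induction r with
  | zero => simp [poch_zero]
  | succ r ih =>
    rw [show 2 * (r + 1) + 1 = 2 * r + 1 + 1 + 1 by ring, Nat.factorial_succ,
      Nat.factorial_succ (2 * r + 1 + 1), Nat.factorial_succ (2 * r + 1), poch_succ, pow_succ]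
    push_cast
    rw [← ih]
    ring

theorem Gamma_half_sub_mul_factorial (r : ℕ) :
    Real.Gamma (1 / 2 - r) * ((2 * r)! : ℝ) = (-4) ^ r * r ! * √π := by
  induction r with
  | zero => simp [Real.Gamma_one_half_eq, -one_div]
  | succ r ih =>
    rw [Gamma_half_sub_eq] at ih
    rw [show 2 * (r + 1) = 2 * r + 1 + 1 by ring, Nat.factorial_succ,
      Nat.factorial_succ (2 * r), Nat.factorial_succ, pow_succ]
    have : (-4 : ℝ) ^ r * -4 * ((r + 1) * r ! : ℝ) * √π
        = -4 * (r + 1) * ((-4 : ℝ) ^ r * r ! * √π) := by ring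
    push_cast at *
    rw [this, ← ih]
    ring

/-! ### Splitting the series into three parts -/

/-- The terms of the half-integral power part of `kernelIntegral (2 * (K + 1)) (2 * √w)`. -/
def sqrtTerm (K : ℕ) (w : ℝ) (r : ℕ) : ℝ :=
  -2 * Real.Gamma (-1 / 2 - K) * √w * ((-w) ^ r / r ! / (poch (3 / 2) r * poch (K + 3 / 2) r))

/-- The terms of the negative power part of `kernelIntegral (2 * (K + 1)) (2 * √w)`. -/
def polarTerm (K : ℕ) (w : ℝ) (r : ℕ) : ℝ :=
  1 / √π * (Real.Gamma K * Real.Gamma (K + 1 / 2) * w ^ (-K : ℤ)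
    * ((-1) ^ r / r ! / (poch (1 / 2 - K) r * poch (1 - K) r)) * w ^ r)

/-- The terms of the logarithmic part of `kernelIntegral (2 * (K + 1)) (2 * √w)`. -/
def logarithmicTerm (K : ℕ) (w : ℝ) (r : ℕ) : ℝ :=
  1 / √π * (w ^ r * (-Real.log w + (psi (1 / 2 - r) + psi (1 + r) + psi (r + K + 1)))
    * ((-1) ^ K * Real.Gamma (1 / 2 - r) / (r ! * (r + K)!)))

/-- The terms of the series `kernelSum j c`. -/
def kernelSumTerm (j : ℕ) (c : ℝ) (n : ℕ) : ℝ :=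
  (c ^ j)⁻¹ * ((logCoeff (fun n => regCoeff n / n !) (fun n => resCoeff n / n !) j).1 n
    + Real.log c * (logCoeff (fun n => regCoeff n / n !) (fun n => resCoeff n / n !) j).2 n) * c ^ n

theorem hasSum_kernelSumTerm (j : ℕ) (c : ℝ) : HasSum (kernelSumTerm j c) (kernelSum j c) := by
  obtain ⟨e1, e2⟩ := entireCoeff_logCoeff entireCoeff_reg entireCoeff_res j
  refine (((e1 c).hasSum.add ((e2 c).hasSum.mul_left (Real.log c))).mul_left (c ^ j)⁻¹).congr_fun ?_
  intro n
  simp only [kernelSumTerm]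
  ring

theorem kernelSumTerm_add (j k : ℕ) {c : ℝ} (hc : 0 < c) : kernelSumTerm j c (j + k)
    = (regCoeff (j + k) + resCoeff (j + k)
      * ((harmonic (j + k) : ℚ) - (harmonic k : ℚ) + Real.log c)) * c ^ k / k ! := by
  obtain ⟨h1, h2⟩ := logCoeff_add regCoeff resCoeff j k
  rw [kernelSumTerm, h1, h2, pow_add]
  field_simp
  ring

theorem kernelSumTerm_lt (n k : ℕ) (c : ℝ) : kernelSumTerm (n + 1 + k) c n
    = (c ^ (n + 1 + k))⁻¹ * (resCoeff n * (-1) ^ k * k !) * c ^ n := by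
  obtain ⟨h1, h2⟩ := logCoeff_lt regCoeff resCoeff n k
  rw [kernelSumTerm, h1, h2, mul_zero, add_zero]

theorem log_two_mul_sqrt {w : ℝ} (hw : 0 < w) :
    Real.log (2 * √w) = Real.log 2 + Real.log w / 2 := by
  rw [Real.log_mul two_ne_zero (Real.sqrt_pos.2 hw).ne', Real.log_sqrt hw.le]

theorem two_mul_sqrt_pow {w : ℝ} (hw : 0 < w) (r : ℕ) : (2 * √w) ^ (2 * r) = 4 ^ r * w ^ r := by
  rw [pow_mul, mul_pow, Real.sq_sqrt hw.le, mul_pow]; norm_num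

/-- The number `H_{2(r+K)+2}` in `regCoeff` cancels against the one created by differentiating the
logarithm. What remains, `2 H_{2r} + H_{r+K} - 3γ - 2 log 2`, is the sum of the three digamma
values. -/
theorem kernelSumTerm_eq_logarithmicTerm (K r : ℕ) {w : ℝ} (hw : 0 < w) :
    kernelSumTerm (2 * (K + 1)) (2 * √w) (2 * (r + (K + 1))) = logarithmicTerm K w r := by
  have hs := Real.sqrt_pos.2 hw
  rw [show 2 * (r + (K + 1)) = 2 * (K + 1) + 2 * r by ring, kernelSumTerm_add _ _ (by positivity),
    show 2 * (K + 1) + 2 * r = 2 * (r + K) + 2 by ring, regCoeff_even, resCoeff_even,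
    two_mul_sqrt_pow hw, log_two_mul_sqrt hw, logarithmicTerm, psi_half_sub, add_comm (1 : ℝ),
    psi_natCast_add_one, ← Nat.cast_add, psi_natCast_add_one]
  have h : Real.Gamma (1 / 2 - r) = (-4) ^ r * r ! * √π / ((2 * r)! : ℝ) := by
    rw [← Gamma_half_sub_mul_factorial, mul_div_cancel_right₀ _ (by positivity)]
  have h4 : (-4 : ℝ) ^ r = (-1) ^ r * 4 ^ r := by rw [← mul_pow]; norm_num
  rw [h, h4, pow_add]
  field_simp
  ring

theorem kernelSumTerm_eq_sqrtTerm (K r : ℕ) {w : ℝ} (hw : 0 < w) :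
    kernelSumTerm (2 * (K + 1)) (2 * √w) (2 * (r + (K + 1)) + 1) = sqrtTerm K w r := by
  have hs := Real.sqrt_pos.2 hw
  have h := poch_one_sub_mul_Gamma (x := -1 / 2 - K) r fun k _ h => by
    have h1 := (Nat.cast_nonneg k : (0 : ℝ) ≤ k)
    have h2 := (Nat.cast_nonneg K : (0 : ℝ) ≤ K)
    linarith
  have hp : poch (3 / 2) r ≠ 0 := by
    intro h0
    have := four_pow_mul_factorial_mul_poch r
    rw [h0, mul_zero] at this
    exact (Nat.factorial_pos (2 * r + 1)).ne' (by exact_mod_cast this.symm)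
  have hp2 : poch (K + 3 / 2) r ≠ 0 := by
    have := ascPochhammer_pos r ((K : ℝ) + 3 / 2) (by positivity)
    exact this.ne'
  rw [show 2 * (r + (K + 1)) + 1 = 2 * (K + 1) + (2 * r + 1) by ring,
    kernelSumTerm_add _ _ (by positivity),
    show 2 * (K + 1) + (2 * r + 1) = 2 * (r + (K + 1)) + 1 by ring, regCoeff_odd, resCoeff_odd,
    sqrtTerm, ← h, ← four_pow_mul_factorial_mul_poch, pow_succ, two_mul_sqrt_pow hw,
    show (1 / 2 - ((r + (K + 1) : ℕ) : ℝ)) = -1 / 2 - K - r by push_cast; ring,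
    show (1 - (-1 / 2 - (K : ℝ))) = K + 3 / 2 by ring, neg_pow w]
  have h1 : ((-1 : ℝ) ^ r) * (-1) ^ r = 1 := by rw [← mul_pow]; norm_num
  generalize poch (K + 3 / 2) r = A at *
  generalize poch (3 / 2) r = B at *
  generalize Real.Gamma (-1 / 2 - K - r) = G at *
  field_simp
  linear_combination G * h1

/-- Below the order of differentiation the term is a factorial times `resCoeff`. Legendre
duplication splits the factorial `(2L+1)!`, `L = K - r - 1`, into two Gamma values, which
`poch_one_sub_mul_Gamma` carries up to `Γ(K)` and `Γ(K + 1/2)`. -/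
theorem kernelSumTerm_eq_polarTerm {K r : ℕ} (hr : r < K) {w : ℝ} (hw : 0 < w) :
    kernelSumTerm (2 * (K + 1)) (2 * √w) (2 * (r + 1)) = polarTerm K w r := by
  have hs := Real.sqrt_pos.2 hw
  obtain ⟨L, rfl⟩ := Nat.exists_eq_add_of_lt hr
  have h1 := poch_one_sub_mul_Gamma (x := ((r + L + 1 : ℕ) : ℝ)) r fun k hk h => by
    have h2 : ((k : ℝ)) < r := by exact_mod_cast hk
    push_cast at h
    linarith [(Nat.cast_nonneg L : (0 : ℝ) ≤ L)]
  have h2 := poch_one_sub_mul_Gamma (x := ((r + L + 1 : ℕ) : ℝ) + 1 / 2) r fun k hk h => by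
    have h2 : ((k : ℝ)) < r := by exact_mod_cast hk
    push_cast at h
    linarith [(Nat.cast_nonneg L : (0 : ℝ) ≤ L)]
  have h3 := Real.Gamma_mul_Gamma_add_half ((L : ℝ) + 1)
  rw [show 2 * ((L : ℝ) + 1) = ((2 * L + 1 : ℕ) : ℝ) + 1 by push_cast; ring,
    Real.Gamma_nat_eq_factorial (2 * L + 1),
    show (1 - (((2 * L + 1 : ℕ) : ℝ) + 1)) = -((2 * L + 1 : ℕ) : ℝ) by ring,
    Real.rpow_neg two_pos.le, Real.rpow_natCast] at h3
  rw [show ((r + L + 1 : ℕ) : ℝ) - r = L + 1 by push_cast; ring] at h1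
  rw [show ((r + L + 1 : ℕ) : ℝ) + 1 / 2 - r = L + 1 + 1 / 2 by push_cast; ring,
    show 1 - (((r + L + 1 : ℕ) : ℝ) + 1 / 2) = 1 / 2 - ((r + L + 1 : ℕ) : ℝ) by ring] at h2
  have g1 : Real.Gamma ((r + L + 1 : ℕ) : ℝ) ≠ 0 := (Real.Gamma_pos_of_pos (by positivity)).ne'
  have g2 : Real.Gamma (((r + L + 1 : ℕ) : ℝ) + 1 / 2) ≠ 0 :=
    (Real.Gamma_pos_of_pos (by positivity)).ne'
  have p1 : poch (1 - ((r + L + 1 : ℕ) : ℝ)) r ≠ 0 := fun h => g1 (by rw [← h1, h]; ring)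
  have p2 : poch (1 / 2 - ((r + L + 1 : ℕ) : ℝ)) r ≠ 0 := fun h => g2 (by rw [← h2, h]; ring)
  have hsq : ((-1 : ℝ) ^ r) * (-1) ^ r = 1 := by rw [← mul_pow]; norm_num
  have h5 : polarTerm (r + L + 1) w r = 1 / √π * ((Real.Gamma (L + 1) * Real.Gamma (L + 1 + 1 / 2))
      * ((-1) ^ r / r !) * ((w ^ (r + L + 1))⁻¹ * w ^ r)) := by
    rw [polarTerm, ← h1, ← h2, zpow_neg, zpow_natCast]
    generalize poch (1 - ((r + L + 1 : ℕ) : ℝ)) r = A at *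
    generalize poch (1 / 2 - ((r + L + 1 : ℕ) : ℝ)) r = B at *
    field_simp
    linear_combination hsq
  rw [h5, h3, show 2 * (r + L + 1 + 1) = 2 * (r + 1) + 1 + (2 * L + 1) by ring, kernelSumTerm_lt,
    show 2 * (r + 1) + 1 + (2 * L + 1) = 2 * (r + L + 1 + 1) by ring, two_mul_sqrt_pow hw,
    two_mul_sqrt_pow hw, show 2 * (r + 1) = 2 * r + 2 by ring, resCoeff_even,
    pow_succ (-1 : ℝ) (2 * L), pow_mul (-1 : ℝ), neg_one_sq, one_pow, pow_succ (2 : ℝ), pow_mul,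
    show (2 : ℝ) ^ 2 = 4 by norm_num, pow_succ (4 : ℝ) (r + L + 1),
    pow_succ (4 : ℝ) (r + L), pow_add (4 : ℝ) r L, pow_succ (4 : ℝ) r, pow_succ w r,
    pow_succ w (r + L + 1)]
  field_simp
  norm_num

/-- The expansion of `kernelIntegral (2 * (K + 1)) (2 * √w)`. -/
theorem kernelIntegral_expansion (K : ℕ) {w : ℝ} (hw : 0 < w) :
    Summable (sqrtTerm K w) ∧ Summable (logarithmicTerm K w) ∧
    kernelIntegral (2 * (K + 1)) (2 * √w) = (∑' r, sqrtTerm K w r)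
      + (∑ r ∈ Finset.range K, polarTerm K w r) + ∑' r, logarithmicTerm K w r := by
  have hs := Real.sqrt_pos.2 hw
  have h := hasSum_kernelSumTerm (2 * (K + 1)) (2 * √w)
  have he : Summable fun m => kernelSumTerm (2 * (K + 1)) (2 * √w) (2 * m) :=
    h.summable.comp_injective (i := fun m => 2 * m) fun a b hab => by simpa using hab
  have ho : Summable fun m => kernelSumTerm (2 * (K + 1)) (2 * √w) (2 * m + 1) :=
    h.summable.comp_injective (i := fun m => 2 * m + 1) fun a b hab => by simpa using hab
  have he' := (summable_nat_add_iff (K + 1)).2 he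
  have ho' := (summable_nat_add_iff (K + 1)).2 ho
  simp only [kernelSumTerm_eq_logarithmicTerm K _ hw] at he'
  simp only [kernelSumTerm_eq_sqrtTerm K _ hw] at ho'
  refine ⟨ho', he', ?_⟩
  rw [kernelIntegral_eq_kernelSum _ (by positivity), pow_mul, neg_one_sq, one_pow, one_mul,
    ← h.tsum_eq, ← tsum_even_add_odd he ho, ← he.sum_add_tsum_nat_add (K + 1),
    ← ho.sum_add_tsum_nat_add (K + 1)]
  simp only [kernelSumTerm_eq_logarithmicTerm K _ hw, kernelSumTerm_eq_sqrtTerm K _ hw]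
  -- Below the order only `resCoeff` survives, and it vanishes at index `0` and at odd indices,
  -- leaving exactly the `K` polar terms.
  have z0 : kernelSumTerm (2 * (K + 1)) (2 * √w) (2 * 0) = 0 := by
    rw [mul_zero, show 2 * (K + 1) = 0 + 1 + (2 * K + 1) by ring, kernelSumTerm_lt, resCoeff_zero]
    ring
  have z1 : ∑ m ∈ Finset.range (K + 1), kernelSumTerm (2 * (K + 1)) (2 * √w) (2 * m + 1) = 0 := by
    refine Finset.sum_eq_zero fun m hm => ?_
    obtain ⟨k, hk⟩ := Nat.exists_eq_add_of_lt (Finset.mem_range.1 hm)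
    rw [show 2 * (K + 1) = 2 * m + 1 + 1 + (2 * k) by omega, kernelSumTerm_lt, resCoeff_odd]
    ring
  have z2 : ∑ m ∈ Finset.range K, kernelSumTerm (2 * (K + 1)) (2 * √w) (2 * (m + 1))
      = ∑ r ∈ Finset.range K, polarTerm K w r :=
    Finset.sum_congr rfl fun m hm => kernelSumTerm_eq_polarTerm (Finset.mem_range.1 hm) hw
  rw [Finset.sum_range_succ', z0, z1, z2]
  ring

/-! ### Termwise integration against the Gamma weight -/

/-- Dominated convergence with an exponential series as majorant: its sum costs `e^(u/2)`, which a
weight `e^(-u)` inside `G` can absorb. -/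
theorem hasSum_integral_of_exp_bound {f : ℕ → ℝ → ℝ} {g G : ℝ → ℝ} (hm : ∀ r, Measurable (f r))
    (hb : ∀ r, ∀ u, 0 < u → |f r u| ≤ G u * ((u / 2) ^ r / r !))
    (hG : IntegrableOn (fun u => G u * Real.exp (u / 2)) (Ioi 0))
    (hs : ∀ u, 0 < u → HasSum (fun r => f r u) (g u)) :
    IntegrableOn g (Ioi 0) ∧ HasSum (fun r => ∫ u in Ioi (0 : ℝ), f r u)
      (∫ u in Ioi (0 : ℝ), g u) := by
  have hS : ∀ u : ℝ, HasSum (fun r : ℕ => G u * ((u / 2) ^ r / r !)) (G u * Real.exp (u / 2)) := by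
    intro u
    rw [Real.exp_eq_exp_ℝ]
    exact (NormedSpace.exp_series_hasSum_exp' (𝕂 := ℝ) (u / 2)).mul_left (G u) |>.congr_fun
      fun r => by simp [div_eq_inv_mul]
  have hpos : ∀ᵐ u ∂volume.restrict (Ioi (0 : ℝ)), 0 < u := ae_restrict_mem measurableSet_Ioi
  constructor
  · refine hG.mono' ?_ ?_
    · refine aestronglyMeasurable_of_tendsto_ae atTop
        (f := fun n u => ∑ r ∈ Finset.range n, f r u)
        (fun n => (Finset.measurable_fun_sum _ fun r _ => hm r).aestronglyMeasurable) ?_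
      filter_upwards [hpos] with u hu using (hs u hu).tendsto_sum_nat
    · filter_upwards [hpos] with u hu
      rw [← (hs u hu).tsum_eq]
      exact tsum_of_norm_bounded (hS u) fun r => hb r u hu
  · refine hasSum_integral_of_dominated_convergence (fun r u => G u * ((u / 2) ^ r / r !))
      (fun r => (hm r).aestronglyMeasurable) (fun r => ?_)
      (Eventually.of_forall fun u => (hS u).summable) ?_ ?_
    · filter_upwards [hpos] with u hu using hb r u hu
    · exact hG.congr_fun (fun u _ => (hS u).tsum_eq.symm) measurableSet_Ioi
    · filter_upwards [hpos] with u hu using hs u hu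

theorem factorial_le_poch {a : ℝ} (ha : 1 ≤ a) (r : ℕ) : (r ! : ℝ) ≤ poch a r := by
  induction r with
  | zero => simp [poch_zero]
  | succ r ih =>
    rw [poch_succ, Nat.factorial_succ, mul_comm]
    push_cast
    exact mul_le_mul ih (by linarith) (by positivity) ((Nat.cast_nonneg _).trans ih)

theorem mul_pow_div_factorial_sq_le {z u : ℝ} (hz : 0 ≤ z) (hu : 0 ≤ u) (r : ℕ) :
    (z * u) ^ r / (r ! * r !) ≤ Real.exp (2 * z) * ((u / 2) ^ r / r !) := by
  have h := Real.pow_div_factorial_le_exp (2 * z) (by positivity) r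
  calc (z * u) ^ r / (r ! * r ! : ℝ) = (2 * z) ^ r / r ! * ((u / 2) ^ r / r !) := by
        rw [show z * u = 2 * z * (u / 2) by ring, mul_pow]; field_simp
    _ ≤ _ := by gcongr

theorem abs_sqrtTerm_le (K : ℕ) {z u : ℝ} (hz : 0 < z) (hu : 0 < u) (r : ℕ) :
    |sqrtTerm K (z * u) r| ≤ 2 * |Real.Gamma (-1 / 2 - K)| * √(z * u) * Real.exp (2 * z)
      * ((u / 2) ^ r / r !) := by
  have h1 := factorial_le_poch (a := 3 / 2) (by norm_num) r
  have h2 := factorial_le_poch (a := K + 3 / 2)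
    (by linarith [(Nat.cast_nonneg K : (0 : ℝ) ≤ K)]) r
  have h0 : (1 : ℝ) ≤ r ! := by exact_mod_cast Nat.factorial_pos r
  have h3 := mul_pow_div_factorial_sq_le hz.le hu.le r
  have e : |sqrtTerm K (z * u) r| = 2 * |Real.Gamma (-1 / 2 - K)| * √(z * u)
      * ((z * u) ^ r / r ! / (poch (3 / 2) r * poch (K + 3 / 2) r)) := by
    rw [sqrtTerm, abs_mul, abs_mul, abs_mul, abs_div, abs_div, abs_mul (poch _ _), abs_pow,
      abs_neg (z * u), abs_of_pos (mul_pos hz hu), abs_of_nonneg (Real.sqrt_nonneg _),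
      Nat.abs_cast, abs_of_pos (a := poch (3 / 2) r) (by linarith),
      abs_of_pos (a := poch (K + 3 / 2) r) (by linarith)]
    norm_num
  rw [e, mul_assoc (2 * _ * _)]
  gcongr
  refine le_trans ?_ h3
  rw [div_div]
  gcongr
  calc (r ! : ℝ) ≤ poch (3 / 2) r * 1 := by linarith
    _ ≤ _ := by gcongr <;> linarith

theorem abs_logarithmicTerm_le (K : ℕ) {z u : ℝ} (hz : 0 < z) (hu : 0 < u) (r : ℕ) :
    |logarithmicTerm K (z * u) r| ≤ (|Real.log z| + (K + 10) + |Real.log u|)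
      * Real.exp (2 * (4 * z)) * ((u / 2) ^ r / r !) := by
  have h0 : (1 : ℝ) ≤ r ! := by exact_mod_cast Nat.factorial_pos r
  -- The factor `4 = 2 * 2` pays for two growths of order `2^r`: the digamma sum and the bound on
  -- `Γ(1/2 - r)`.
  have h3 := mul_pow_div_factorial_sq_le (z := 4 * z) (by positivity) hu.le r
  have hr : (r : ℝ) + 1 ≤ 2 ^ r := by exact_mod_cast Nat.lt_two_pow_self
  have hr1 : (1 : ℝ) ≤ 2 ^ r := one_le_pow₀ one_le_two
  have hK : (0 : ℝ) ≤ K := Nat.cast_nonneg K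
  have hr0 : (0 : ℝ) ≤ r := Nat.cast_nonneg r
  have hpsi : |psi (1 / 2 - r) + psi (1 + r) + psi (r + K + 1)| ≤ (K + 10) * 2 ^ r := by
    rw [psi_half_sub, add_comm (1 : ℝ), psi_natCast_add_one, ← Nat.cast_add, psi_natCast_add_one]
    have h4 := abs_cast_harmonic_le (2 * r)
    have h5 := abs_cast_harmonic_le (r + K)
    have h6 := Real.eulerMascheroniConstant_lt_two_thirds
    have h7 := Real.one_half_lt_eulerMascheroniConstant
    have h8 := Real.log_two_lt_d9
    have h9 := Real.log_two_gt_d9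
    push_cast at h4 h5
    have : 5 * (r : ℝ) + K + 5 ≤ (K + 10) * 2 ^ r := by nlinarith
    rw [abs_le] at *
    constructor <;> linarith
  have hlog : |-Real.log (z * u) + (psi (1 / 2 - r) + psi (1 + r) + psi (r + K + 1))|
      ≤ (|Real.log z| + (K + 10) + |Real.log u|) * 2 ^ r := by
    rw [Real.log_mul hz.ne' hu.ne']
    have h10 := abs_nonneg (Real.log z)
    have h11 := abs_nonneg (Real.log u)
    calc _ ≤ |Real.log z| + |Real.log u| + (K + 10) * 2 ^ r := by
          refine (abs_add_le _ _).trans ?_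
          rw [abs_neg]
          gcongr
          exact abs_add_le _ _
      _ ≤ _ := by nlinarith
  have hG := abs_Gamma_half_sub_le r
  have hf : (r ! : ℝ) ≤ (r + K)! := by exact_mod_cast Nat.factorial_le (Nat.le_add_right r K)
  have hpi : 0 < √π := Real.sqrt_pos.2 Real.pi_pos
  rw [logarithmicTerm, abs_mul, abs_mul, abs_mul, abs_div, abs_div, abs_mul ((-1) ^ K), abs_mul,
    abs_pow, abs_pow, abs_neg (1 : ℝ), abs_one, one_pow, one_mul, Nat.abs_cast, Nat.abs_cast,
    abs_of_pos (mul_pos hz hu), abs_of_pos hpi]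
  calc _ ≤ 1 / √π * ((z * u) ^ r * ((|Real.log z| + (K + 10) + |Real.log u|) * 2 ^ r)
        * (√π * 2 ^ r / (r ! * r !))) := by gcongr
    _ = (|Real.log z| + (K + 10) + |Real.log u|) * ((4 * z * u) ^ r / (r ! * r !)) := by
        rw [show 4 * z * u = z * u * (2 * 2) by ring, mul_pow _ (2 * 2 : ℝ), mul_pow (2 : ℝ)]
        field_simp
    _ ≤ _ := by
        rw [mul_assoc _ (Real.exp _)]
        gcongr

theorem integral_rpow_mul_exp_neg {s : ℝ} (hs : 0 < s) :
    ∫ u in Ioi (0 : ℝ), u ^ (s - 1) * Real.exp (-u) = Real.Gamma s := by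
  rw [Real.Gamma_eq_integral hs]
  congr 1 with u
  ring

theorem exp_neg_mul_exp_half (u : ℝ) :
    Real.exp (-u) * Real.exp (u / 2) = Real.exp (-(1 / 2 * u)) := by
  rw [← Real.exp_add]; ring_nf

theorem hasSum_integral_sqrtTerm (K : ℕ) {z s : ℝ} (hz : 0 < z) (hs : 0 < s) :
    IntegrableOn (fun u => u ^ (s - 1) * Real.exp (-u) * ∑' r, sqrtTerm K (z * u) r) (Ioi 0) ∧
    HasSum (fun r : ℕ => Real.Gamma (s + 1 / 2 + r) * sqrtTerm K z r)
      (∫ u in Ioi (0 : ℝ), u ^ (s - 1) * Real.exp (-u) * ∑' r, sqrtTerm K (z * u) r) := by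
  have h := hasSum_integral_of_exp_bound
    (f := fun r u => u ^ (s - 1) * Real.exp (-u) * sqrtTerm K (z * u) r)
    (g := fun u => u ^ (s - 1) * Real.exp (-u) * ∑' r, sqrtTerm K (z * u) r)
    (G := fun u => u ^ (s - 1) * Real.exp (-u)
      * (2 * |Real.Gamma (-1 / 2 - K)| * √(z * u) * Real.exp (2 * z)))
    (fun r => by unfold sqrtTerm; fun_prop) (fun r u hu => ?_) ?_ (fun u hu => ?_)
  · refine ⟨h.1, h.2.congr_fun fun r => ?_⟩
    have e : ∀ u ∈ Ioi (0 : ℝ), u ^ (s - 1) * Real.exp (-u) * sqrtTerm K (z * u) r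
        = sqrtTerm K z r * (u ^ (s + 1 / 2 + r - 1) * Real.exp (-u)) := by
      intro u hu
      have hu : 0 < u := hu
      rw [sqrtTerm, sqrtTerm, Real.sqrt_mul hz.le,
        show s + 1 / 2 + r - 1 = (s - 1) + 1 / 2 + r by ring, Real.rpow_add hu, Real.rpow_add hu,
        Real.rpow_natCast, Real.sqrt_eq_rpow u, ← neg_mul, mul_pow]
      ring
    rw [setIntegral_congr_fun measurableSet_Ioi e, integral_const_mul,
      integral_rpow_mul_exp_neg (by positivity)]
    ring
  · have := abs_sqrtTerm_le K hz hu r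
    rw [abs_mul, abs_of_nonneg (by positivity), mul_assoc _ _ ((u / 2) ^ r / r ! : ℝ)]
    gcongr
  · have := (integrableOn_rpow_mul_exp_neg (s := s + 1 / 2) (a := 1 / 2)
      (by positivity) (by norm_num)).const_mul (2 * |Real.Gamma (-1 / 2 - K)| * √z * Real.exp (2 * z))
    refine IntegrableOn.congr_fun this (fun u hu => ?_) measurableSet_Ioi
    have hu : 0 < u := hu
    rw [← exp_neg_mul_exp_half, Real.sqrt_mul hz.le, show s + 1 / 2 - 1 = (s - 1) + 1 / 2 by ring,
      Real.rpow_add hu, Real.sqrt_eq_rpow u]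
    ring
  · exact (kernelIntegral_expansion K (mul_pos hz hu)).1.hasSum.mul_left _

/-- Splitting `log (z u) = log z + log u`, the second part integrates to `Γ'(s + r) = Γ(s + r) ψ(s +
r)`, which inserts `-ψ(s + r)` among the digamma values. -/
theorem hasSum_integral_logarithmicTerm (K : ℕ) {z s : ℝ} (hz : 0 < z) (hs : 0 < s) :
    IntegrableOn (fun u => u ^ (s - 1) * Real.exp (-u) * ∑' r, logarithmicTerm K (z * u) r)
      (Ioi 0) ∧
    HasSum (fun r : ℕ => 1 / √π * (z ^ r * (-Real.log z
        + (psi (1 / 2 - r) - psi (s + r) + psi (1 + r) + psi (r + K + 1)))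
        * ((-1) ^ K * Real.Gamma (1 / 2 - r) * Real.Gamma (s + r) / (r ! * (r + K)!))))
      (∫ u in Ioi (0 : ℝ), u ^ (s - 1) * Real.exp (-u) * ∑' r, logarithmicTerm K (z * u) r) := by
  have h := hasSum_integral_of_exp_bound
    (f := fun r u => u ^ (s - 1) * Real.exp (-u) * logarithmicTerm K (z * u) r)
    (g := fun u => u ^ (s - 1) * Real.exp (-u) * ∑' r, logarithmicTerm K (z * u) r)
    (G := fun u => u ^ (s - 1) * Real.exp (-u)
      * ((|Real.log z| + (K + 10) + |Real.log u|) * Real.exp (2 * (4 * z))))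
    (fun r => by unfold logarithmicTerm; fun_prop) (fun r u hu => ?_) ?_ (fun u hu => ?_)
  · refine ⟨h.1, h.2.congr_fun fun r => ?_⟩
    have hsr : 0 < s + r := by positivity
    set A := psi (1 / 2 - r) + psi (1 + r) + psi (r + K + 1) with hA
    set B := (-1) ^ K * Real.Gamma (1 / 2 - r) / (r ! * (r + K)! : ℝ) with hB
    have e : ∀ u ∈ Ioi (0 : ℝ), u ^ (s - 1) * Real.exp (-u) * logarithmicTerm K (z * u) r
        = 1 / √π * z ^ r * B * (-Real.log z + A) * (u ^ (s + r - 1) * Real.exp (-u))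
          - 1 / √π * z ^ r * B * (u ^ (s + r - 1) * Real.log u * Real.exp (-u)) := by
      intro u hu
      have hu : 0 < u := hu
      rw [logarithmicTerm, ← hA, ← hB, show s + r - 1 = (s - 1) + r by ring, Real.rpow_add hu,
        Real.rpow_natCast, mul_pow, Real.log_mul hz.ne' hu.ne']
      ring
    have i1 := integrableOn_rpow_mul_exp_neg hsr one_pos
    simp only [one_mul] at i1
    rw [setIntegral_congr_fun measurableSet_Ioi e, integral_sub (i1.const_mul _)
      ((integrableOn_rpow_mul_log_mul_exp_neg hsr).const_mul _), integral_const_mul,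
      integral_const_mul, integral_rpow_mul_exp_neg hsr, integral_rpow_mul_log_mul_exp_neg hsr]
    have hd : deriv Real.Gamma (s + r) = Real.Gamma (s + r) * psi (s + r) := by
      rw [psi, logDeriv_apply, mul_div_cancel₀ _ (Real.Gamma_pos_of_pos hsr).ne']
    rw [hd, hA, hB]
    ring
  · have := abs_logarithmicTerm_le K hz hu r
    rw [abs_mul, abs_of_nonneg (by positivity), mul_assoc _ _ ((u / 2) ^ r / r ! : ℝ)]
    gcongr
  · have h1 := (integrableOn_rpow_mul_exp_neg hs one_half_pos).const_mul
      ((|Real.log z| + (K + 10)) * Real.exp (2 * (4 * z)))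
    have h2 := (integrableOn_rpow_mul_abs_log_mul_exp_neg hs one_half_pos).const_mul
      (Real.exp (2 * (4 * z)))
    refine IntegrableOn.congr_fun (h1.add h2) (fun u hu => ?_) measurableSet_Ioi
    simp only [Pi.add_apply]
    rw [← exp_neg_mul_exp_half]
    ring
  · exact (kernelIntegral_expansion K (mul_pos hz hu)).2.1.hasSum.mul_left _

/-- The factor `u^(r-K)` lowers the exponent only to `β + r - 1`, so the integral still converges at
`0`. -/
theorem integral_polarTerm {K r : ℕ} {z β : ℝ} (hβ : 0 < β) :
    IntegrableOn (fun u => u ^ (β + K - 1) * Real.exp (-u) * polarTerm K (z * u) r) (Ioi 0) ∧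
    ∫ u in Ioi (0 : ℝ), u ^ (β + K - 1) * Real.exp (-u) * polarTerm K (z * u) r
      = polarTerm K z r * Real.Gamma (β + r) := by
  have hr : 0 < β + r := by positivity
  have e : ∀ u ∈ Ioi (0 : ℝ), polarTerm K z r * (u ^ (β + r - 1) * Real.exp (-u))
      = u ^ (β + K - 1) * Real.exp (-u) * polarTerm K (z * u) r := by
    intro u hu
    have hu : 0 < u := hu
    rw [polarTerm, polarTerm, show β + r - 1 = (β + K - 1) + (-K : ℤ) + r by push_cast; ring,
      Real.rpow_add hu, Real.rpow_add hu, Real.rpow_intCast, Real.rpow_natCast, mul_pow, mul_zpow]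
    ring
  have i1 := integrableOn_rpow_mul_exp_neg hr one_pos
  simp only [one_mul] at i1
  refine ⟨IntegrableOn.congr_fun (i1.const_mul _) e measurableSet_Ioi, ?_⟩
  rw [← setIntegral_congr_fun measurableSet_Ioi e, integral_const_mul, integral_rpow_mul_exp_neg hr]

/-! ### Reduction of the reaction integral to the kernel -/

theorem measurable_integrand (γ a ρ b α : ℝ) : Measurable (integrand γ a ρ b α) := by
  unfold integrand; fun_prop

theorem integrand_eq (K : ℕ) (b α : ℝ) {x : ℝ} (hx : 0 < x) :
    integrand (-(K + 1) + 1) 1 (1 / 2) b α x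
      = (x ^ (K + 1))⁻¹ * (1 + (α - 1) * x) ^ (-(1 / (α - 1)))
        * Real.exp (-b * x ^ (-(1 / 2) : ℝ)) := by
  rw [integrand, one_mul, show (-((K : ℝ) + 1) + 1 - 1) = -((K + 1 : ℕ) : ℝ) by push_cast; ring,
    Real.rpow_neg hx.le, Real.rpow_natCast]

theorem rpow_neg_half_sq_pow {x : ℝ} (hx : 0 < x) (n : ℕ) :
    (x ^ (-(1 / 2) : ℝ)) ^ (2 * n) = (x ^ n)⁻¹ := by
  rw [pow_mul, ← Real.rpow_mul_natCast hx.le, ← inv_pow]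
  congr 1
  rw [← Real.rpow_neg_one]
  norm_num

/-- On `(0, 1]` the exponential dominates the pole of order `K + 1`; beyond `1` the integrand is at
most a constant times `x^(-1-1/(α-1))`. -/
theorem integrableOn_integrand (K : ℕ) {b α : ℝ} (hb : 0 < b) (hα : 1 < α) :
    IntegrableOn (integrand (-(K + 1) + 1) 1 (1 / 2) b α) (Ioi 0) := by
  have ha : 0 < α - 1 := by linarith
  have hβ : 0 < 1 / (α - 1) := by positivity
  rw [← Ioc_union_Ioi_eq_Ioi zero_le_one]
  refine IntegrableOn.union ?_ ?_
  · refine Measure.integrableOn_of_bounded (M := ((2 * (K + 1))! : ℝ) / b ^ (2 * (K + 1)))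
      (by simp) (measurable_integrand _ _ _ _ _).aestronglyMeasurable ?_
    filter_upwards [ae_restrict_mem measurableSet_Ioc] with x hx
    have hx0 := hx.1
    rw [integrand_eq K b α hx0, Real.norm_of_nonneg (by positivity), ← rpow_neg_half_sq_pow hx0,
      mul_right_comm]
    have h1 := pow_mul_exp_neg_le (2 * (K + 1)) hb (Real.rpow_nonneg hx0.le (-(1 / 2)))
    have h2 : (1 + (α - 1) * x) ^ (-(1 / (α - 1))) ≤ 1 :=
      Real.rpow_le_one_of_one_le_of_nonpos (by nlinarith) (by linarith)
    rw [neg_mul]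
    calc _ ≤ ((2 * (K + 1))! : ℝ) / b ^ (2 * (K + 1)) * 1 := by gcongr
      _ = _ := mul_one _
  · have h := (integrableOn_Ioi_rpow_of_lt (a := -1 - 1 / (α - 1)) (c := 1)
      (by linarith) one_pos).const_mul ((α - 1) ^ (-(1 / (α - 1))))
    refine h.mono' (measurable_integrand _ _ _ _ _).aestronglyMeasurable ?_
    filter_upwards [ae_restrict_mem measurableSet_Ioi] with x hx
    have hx1 : 1 < x := hx
    have hx0 : 0 < x := by linarith
    rw [integrand_eq K b α hx0, Real.norm_of_nonneg (by positivity)]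
    have h1 : (x ^ (K + 1))⁻¹ ≤ x⁻¹ := by
      gcongr
      exact le_self_pow₀ hx1.le (by omega)
    have h2 : (1 + (α - 1) * x) ^ (-(1 / (α - 1))) ≤ ((α - 1) * x) ^ (-(1 / (α - 1))) :=
      Real.rpow_le_rpow_of_nonpos (by positivity) (by linarith) (by linarith)
    have h3 : Real.exp (-b * x ^ (-(1 / 2) : ℝ)) ≤ 1 := by
      rw [Real.exp_le_one_iff, neg_mul, neg_nonpos]; positivity
    calc _ ≤ x⁻¹ * ((α - 1) * x) ^ (-(1 / (α - 1))) * 1 := by gcongr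
      _ = _ := by
        rw [Real.mul_rpow ha.le hx0.le, sub_eq_add_neg (-1 : ℝ), Real.rpow_add hx0,
          Real.rpow_neg_one]
        ring

theorem integral_scaled_kernel (K : ℕ) {b v : ℝ} (hv : 0 < v) :
    ∫ x in Ioi (0 : ℝ), (x ^ (K + 1))⁻¹ * Real.exp (-b * x ^ (-(1 / 2) : ℝ)) * Real.exp (-(v * x))
      = v ^ K * kernelIntegral (2 * (K + 1)) (b * √v) := by
  have h := integral_comp_mul_left_Ioi (kernel (2 * (K + 1)) (b * √v)) 0 hv
  rw [mul_zero, smul_eq_mul] at h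
  have h2 : v ^ K * kernelIntegral (2 * (K + 1)) (b * √v)
      = v ^ (K + 1) * ∫ x in Ioi (0 : ℝ), kernel (2 * (K + 1)) (b * √v) (v * x) := by
    rw [h, kernelIntegral, pow_succ]
    field_simp
  rw [h2, ← integral_const_mul]
  refine setIntegral_congr_fun measurableSet_Ioi fun x hx => ?_
  have hx : 0 < x := hx
  have h3 : √v * v ^ (-(1 / 2) : ℝ) = 1 := by
    rw [Real.sqrt_eq_rpow, ← Real.rpow_add hv]; norm_num
  simp only [kernel]
  rw [rpow_neg_half_sq_pow (mul_pos hv hx), mul_pow, Real.mul_rpow hv.le hx.le,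
    show b * √v * (v ^ (-(1 / 2) : ℝ) * x ^ (-(1 / 2) : ℝ))
      = b * (√v * v ^ (-(1 / 2) : ℝ)) * x ^ (-(1 / 2) : ℝ) by ring, h3, mul_assoc, ← Real.exp_add]
  field_simp
  ring_nf

/-- The reaction probability integral as an integral of `kernelIntegral`. -/
theorem Gamma_mul_I1 (K : ℕ) {b α z : ℝ} (hb : 0 < b) (hα : 1 < α)
    (hz : z = (α - 1) * b ^ 2 / 4) :
    Real.Gamma (1 / (α - 1)) * I1 (-(K + 1) + 1) 1 (1 / 2) b α
      = (α - 1) ^ K * ∫ u in Ioi (0 : ℝ), u ^ (1 / (α - 1) + K - 1) * Real.exp (-u)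
        * kernelIntegral (2 * (K + 1)) (2 * √(z * u)) := by
  have ha : 0 < α - 1 := by linarith
  set a := α - 1 with hadef
  set β := 1 / a with hβdef
  have hβ : 0 < β := by positivity
  let F : ℝ → ℝ → ℝ := fun x u => (x ^ (K + 1))⁻¹ * Real.exp (-b * x ^ (-(1 / 2) : ℝ))
    * (u ^ (β - 1) * Real.exp (-((1 + a * x) * u)))
  have hinner : ∀ x ∈ Ioi (0 : ℝ), ∫ u in Ioi (0 : ℝ), F x u
      = Real.Gamma β * integrand (-(K + 1) + 1) 1 (1 / 2) b α x := by
    intro x hx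
    have hx : 0 < x := hx
    have h1 : 0 < 1 + a * x := by positivity
    simp only [F]
    rw [integral_const_mul, Real.integral_rpow_mul_exp_neg_mul_Ioi hβ h1, integrand_eq K b α hx,
      ← hadef, ← hβdef, Real.rpow_neg h1.le, one_div (1 + a * x), Real.inv_rpow h1.le]
    ring
  -- As `F` is positive, the inner integral of its norm is again `Γ(β)` times the integrand, already
  -- known to be integrable.
  have hint : Integrable (Function.uncurry F)
      ((volume.restrict (Ioi (0 : ℝ))).prod (volume.restrict (Ioi (0 : ℝ)))) := by
    have hm : Measurable (Function.uncurry F) := by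
      simp only [F, Function.uncurry_def]
      fun_prop
    rw [integrable_prod_iff hm.aestronglyMeasurable]
    constructor
    · filter_upwards [ae_restrict_mem measurableSet_Ioi] with x hx
      have hx : 0 < x := hx
      have h := (integrableOn_rpow_mul_exp_neg (a := 1 + a * x) hβ (by positivity)).const_mul
        ((x ^ (K + 1))⁻¹ * Real.exp (-b * x ^ (-(1 / 2) : ℝ)))
      exact h
    · refine Integrable.congr ((integrableOn_integrand K hb hα).const_mul (Real.Gamma β)) ?_
      filter_upwards [ae_restrict_mem measurableSet_Ioi] with x hx
      rw [← hinner x hx]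
      refine setIntegral_congr_fun measurableSet_Ioi fun u hu => ?_
      have hx : 0 < x := hx
      have hu : 0 < u := hu
      simp only [F, Function.uncurry_apply_pair]
      rw [Real.norm_of_nonneg (by positivity)]
  rw [I1, ← integral_const_mul, ← setIntegral_congr_fun measurableSet_Ioi hinner,
    integral_integral_swap hint, ← integral_const_mul]
  refine setIntegral_congr_fun measurableSet_Ioi fun u hu => ?_
  have hu : 0 < u := hu
  have e : ∀ x, F x u = u ^ (β - 1) * Real.exp (-u)
      * ((x ^ (K + 1))⁻¹ * Real.exp (-b * x ^ (-(1 / 2) : ℝ)) * Real.exp (-(a * u * x))) := by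
    intro x
    simp only [F]
    rw [show -((1 + a * x) * u) = -u + -(a * u * x) by ring, Real.exp_add]
    ring
  simp only [e]
  -- The choice `z = a b² / 4` is made for this identity.
  have hsq : 2 * √(z * u) = b * √(a * u) := by
    rw [hz, show a * b ^ 2 / 4 * u = (b / 2) ^ 2 * (a * u) by ring,
      Real.sqrt_mul (sq_nonneg _), Real.sqrt_sq (by positivity)]
    ring
  rw [integral_const_mul, integral_scaled_kernel K (mul_pos ha hu), hsq,
    show β + K - 1 = β - 1 + K by ring, Real.rpow_add hu, Real.rpow_natCast, mul_pow]
  ring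

/-! ### Assembling the three series -/

theorem Gamma_mul_sqrtTerm (K : ℕ) {z s : ℝ} (hs : 0 < s) (r : ℕ) :
    Real.Gamma (s + r) * sqrtTerm K z r = -2 * Real.Gamma s * Real.Gamma (-1 / 2 - K) * √z
      * hyp1F2Term s (3 / 2) (K + 3 / 2) (-z) r := by
  rw [Gamma_add_natCast hs, sqrtTerm, hyp1F2Term]
  ring

/-- The integral of the kernel expansion, in terms of the three series. -/
theorem integral_kernelIntegral (K : ℕ) {β z : ℝ} (hβ : 0 < β) (hz : 0 < z) :
    Summable (hyp1F2Term (β + K + 1 / 2) (3 / 2) (K + 3 / 2) (-z)) ∧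
    Summable (fun r : ℕ => z ^ r * (-Real.log z
        + (psi (1 / 2 - r) - psi (β + K + r) + psi (1 + r) + psi (r + K + 1)))
        * ((-1) ^ K * Real.Gamma (1 / 2 - r) * Real.Gamma (β + K + r) / (r ! * (r + K)!))) ∧
    ∫ u in Ioi (0 : ℝ), u ^ (β + K - 1) * Real.exp (-u)
        * kernelIntegral (2 * (K + 1)) (2 * √(z * u))
      = 1 / √π * (-2 * √π * Real.Gamma (β + K + 1 / 2) * Real.Gamma (-1 / 2 - K) * √z
          * hyp1F2 (β + K + 1 / 2) (3 / 2) (K + 3 / 2) (-z)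
        + Real.Gamma K * Real.Gamma (K + 1 / 2) * Real.Gamma β * z ^ (-K : ℤ)
          * ∑ r ∈ Finset.range K, (-1) ^ r / (r ! : ℝ)
            * (poch β r / (poch (1 / 2 - K) r * poch (1 - K) r)) * z ^ r
        + ∑' r : ℕ, z ^ r * (-Real.log z
          + (psi (1 / 2 - r) - psi (β + K + r) + psi (1 + r) + psi (r + K + 1)))
          * ((-1) ^ K * Real.Gamma (1 / 2 - r) * Real.Gamma (β + K + r) / (r ! * (r + K)!))) := by
  have hs : 0 < β + K := by positivity
  have hs2 : 0 < β + K + 1 / 2 := by positivity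
  have hpi : 0 < √π := Real.sqrt_pos.2 Real.pi_pos
  obtain ⟨i1, s1⟩ := hasSum_integral_sqrtTerm K hz hs
  obtain ⟨i2, s2⟩ := hasSum_integral_logarithmicTerm K hz hs
  have i3 := fun r (_ : r ∈ Finset.range K) => (integral_polarTerm (K := K) (r := r) (z := z) hβ).1
  simp only [Gamma_mul_sqrtTerm K hs2] at s1
  -- A nonzero prefactor lets summability pass back to the bare hypergeometric series.
  have hne : -2 * Real.Gamma (β + K + 1 / 2) * Real.Gamma (-1 / 2 - K) * √z ≠ 0 := by
    have h1 := (Real.Gamma_pos_of_pos hs2).ne'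
    have h2 : Real.Gamma (-1 / 2 - K) ≠ 0 := by
      refine Real.Gamma_ne_zero fun m => ?_
      have := Gamma_half_sub_ne (K + 1) m
      rwa [show (1 / 2 - ((K + 1 : ℕ) : ℝ)) = -1 / 2 - K by push_cast; ring] at this
    have h3 := (Real.sqrt_pos.2 hz).ne'
    exact mul_ne_zero (mul_ne_zero (mul_ne_zero (by norm_num) h1) h2) h3
  have hpi' : 1 / √π ≠ 0 := by positivity
  refine ⟨(summable_mul_left_iff hne).1 s1.summable,
    (summable_mul_left_iff hpi').1 (s2.summable.congr fun r => by ring), ?_⟩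
  have e : ∀ u ∈ Ioi (0 : ℝ), u ^ (β + K - 1) * Real.exp (-u)
        * kernelIntegral (2 * (K + 1)) (2 * √(z * u))
      = u ^ (β + K - 1) * Real.exp (-u) * (∑' r, sqrtTerm K (z * u) r)
        + ∑ r ∈ Finset.range K, u ^ (β + K - 1) * Real.exp (-u) * polarTerm K (z * u) r
        + u ^ (β + K - 1) * Real.exp (-u) * ∑' r, logarithmicTerm K (z * u) r := by
    intro u hu
    rw [(kernelIntegral_expansion K (mul_pos hz hu)).2.2, ← Finset.mul_sum]
    ring
  have i4 := integrable_finsetSum _ i3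
  have i5 : IntegrableOn (fun u => u ^ (β + K - 1) * Real.exp (-u) * (∑' r, sqrtTerm K (z * u) r)
      + ∑ r ∈ Finset.range K, u ^ (β + K - 1) * Real.exp (-u) * polarTerm K (z * u) r) (Ioi 0) :=
    Integrable.add i1 i4
  rw [setIntegral_congr_fun measurableSet_Ioi e, integral_add i5 i2, integral_add i1 i4,
    integral_finsetSum _ i3, ← s1.tsum_eq, ← s2.tsum_eq]
  simp only [(integral_polarTerm hβ).2, tsum_mul_left, hyp1F2]
  rw [mul_add, mul_add]
  congr 2
  · field_simp
  · rw [Finset.mul_sum, Finset.mul_sum]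
    refine Finset.sum_congr rfl fun r _ => ?_
    rw [polarTerm, Gamma_add_natCast hβ]
    ring

theorem logTerm_neg (K : ℕ) (α z : ℝ) (r : ℕ) : logTerm (-(K + 1)) α z r
    = z ^ r * (-Real.log z + (psi (1 / 2 - r) - psi (1 / (α - 1) + K + r)
        + psi (1 + r) + psi (r + K + 1)))
      * ((-1) ^ K * Real.Gamma (1 / 2 - r) * Real.Gamma (1 / (α - 1) + K + r)
        / (r ! * (r + K)!)) := by
  have h1 : ((r : ℤ) - (-((K : ℤ) + 1)) - 1).toNat = r + K := by omega
  have h2 : (1 : ℤ) + -((K : ℤ) + 1) = -K := by ring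
  have h3 : ((-1 : ℝ)) ^ (-(K : ℤ)) = (-1) ^ K := by
    rw [zpow_neg, zpow_natCast, ← inv_pow]; norm_num
  rw [logTerm, coeffA, coeffB, h1, h2, h3]
  push_cast
  rw [show 1 / (α - 1) - 1 - -((K : ℝ) + 1) + r = 1 / (α - 1) + K + r by ring,
    show (r : ℝ) - -((K : ℝ) + 1) = r + K + 1 by ring]

end PathwayIntegral

end

theorem mainTheorem3 (ν : ℤ) (hν : ν < 0) (b α z : ℝ) (hb : 0 < b) (hα : 1 < α)
    (hz : z = (α - 1) * b ^ 2 / 4) :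
    IntegrableOn (PathwayIntegral.integrand (ν + 1) 1 (1 / 2) b α) (Ioi 0) ∧
    Summable (PathwayIntegral.hyp1F2Term
      (1 / (α - 1) - 1 / 2 - ν) (3 / 2) (1 / 2 - ν) (-z)) ∧
    Summable (PathwayIntegral.logTerm ν α z) ∧
    PathwayIntegral.I1 (ν + 1) 1 (1 / 2) b α =
      1 / (Real.sqrt Real.pi * (α - 1) ^ (ν + 1) * Real.Gamma (1 / (α - 1))) *
        (-2 * Real.sqrt Real.pi * Real.Gamma (1 / (α - 1) - 1 / 2 - ν)
            * Real.Gamma (1 / 2 + ν) * Real.sqrt z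
            * PathwayIntegral.hyp1F2 (1 / (α - 1) - 1 / 2 - ν) (3 / 2) (1 / 2 - ν) (-z)
          + Real.Gamma (-1 - ν) * Real.Gamma (-1 / 2 - ν) * Real.Gamma (1 / (α - 1))
            * z ^ (1 + ν)
            * ∑ r ∈ Finset.range (-ν - 1).toNat,
                (-1) ^ r / (r ! : ℝ)
                  * (PathwayIntegral.poch (1 / (α - 1)) r
                    / (PathwayIntegral.poch (3 / 2 + ν) r * PathwayIntegral.poch (2 + ν) r))
                  * z ^ r
          + ∑' r : ℕ, PathwayIntegral.logTerm ν α z r) := by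
  -- With `K = -ν - 1`, the case `ν = -1` is `K = 0`: the finite sum is empty, so the value assigned
  -- to `Γ(0)` is immaterial.
  obtain ⟨K, rfl⟩ : ∃ K : ℕ, ν = -((K : ℤ) + 1) := ⟨(-ν - 1).toNat, by omega⟩
  have ha : 0 < α - 1 := by linarith
  have hβ : 0 < 1 / (α - 1) := by positivity
  have hz0 : 0 < z := by rw [hz]; positivity
  obtain ⟨h1, h2, h3⟩ := PathwayIntegral.integral_kernelIntegral K hβ hz0
  have hI := PathwayIntegral.Gamma_mul_I1 K hb hα hz
  have hG := Real.Gamma_pos_of_pos hβ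
  have hr : (-(-((K : ℤ) + 1)) - 1).toNat = K := by omega
  have hp : (1 : ℤ) + -((K : ℤ) + 1) = -K := by ring
  have hp' : -((K : ℤ) + 1) + 1 = -K := by ring
  have hlog : PathwayIntegral.logTerm (-((K : ℤ) + 1)) α z = _ :=
    funext fun r => PathwayIntegral.logTerm_neg K α z r
  rw [hr, hp, hp', hlog]
  push_cast
  rw [show 1 / (α - 1) - 1 / 2 - -((K : ℝ) + 1) = 1 / (α - 1) + K + 1 / 2 by ring,
    show 1 / 2 - -((K : ℝ) + 1) = K + 3 / 2 by ring,
    show 1 / 2 + -((K : ℝ) + 1) = -1 / 2 - K by ring,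
    show -1 - -((K : ℝ) + 1) = K by ring,
    show -1 / 2 - -((K : ℝ) + 1) = K + 1 / 2 by ring,
    show 3 / 2 + -((K : ℝ) + 1) = 1 / 2 - K by ring,
    show 2 + -((K : ℝ) + 1) = 1 - K by ring]
  refine ⟨PathwayIntegral.integrableOn_integrand K hb hα, h1, h2, ?_⟩
  rw [h3] at hI
  have key : ∀ X : ℝ, (α - 1) ^ K * (1 / √Real.pi * X) = Real.Gamma (1 / (α - 1))
      * (1 / (√Real.pi * (α - 1) ^ (-(K : ℤ)) * Real.Gamma (1 / (α - 1))) * X) := by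
    intro X
    rw [zpow_neg, zpow_natCast]
    generalize Real.Gamma (1 / (α - 1)) = G at hG
    field_simp
  rw [← mul_right_inj' hG.ne', hI]
  exact key _
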